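/- Let $L_2$ be the two-sorted language of second order arithmetic, with number variables, set variables, $0,1,+,\cdot,<$, equality between numbers, and $\in$ between numbers and sets. An $L_2$-structure consists of a (possibly nonstandard) interpretation $M$ of the number part, together with a collection $\mathcal S\subseteq\mathcal P(M)$ over which set variables range. $\mathsf{RCA}_0$ is the theory consisting of the universal closures of the basic axioms $$n+1\neq0,\quad m+1=n+1\to m=n,\quad m+0=m,\quad m+(n+1)=(m+n)+1,$$ $$m\cdot0=0,\quad m\cdot(n+1)=m\cdot n+m,\quad \neg\, m<0,\quad m<n+1\leftrightarrow(m<n\vee m=n),$$ of $\Sigma^0_1$ induction $(\varphi(0)\wedge\forall n(\varphi(n)\to\varphi(n+1)))\to\forall n\,\varphi(n)$ for $\varphi\in\Sigma^0_1$, and of $\Delta^0_1$ comprehension $\forall n(\varphi(n)\leftrightarrow\psi(n))\to\exists X\forall n(n\in X\leftrightarrow\varphi(n))$ for $\varphi\in\Sigma^0_1$, $\psi\in\Pi^0_1$, $X$ not free in $\varphi$; number and set parameters are allowed in both schemes. Within $\mathsf{RCA}_0$ make the following definitions, where pairs are coded by $(i,j)=(i+j)^2+i$. * A partial order $(P,\preceq)$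 consists of a set $P\subseteq\mathbb N$ and a set ${\preceq}\subseteq P\times P$ that is a reflexive, antisymmetric and transitive relation on $P$. * A set $I\subseteq P$ is an initial interval of $P$ if $x\preceq y$ and $y\in I$ imply $x\in I$, for all $x,y\in P$. * $P$ has countably many initial intervals if there is a sequence of sets $\{I_n: n\in\mathbb N\}$, coded by a single set $Z$ via $I_n=\{x:(n,x)\in Z\}$, such that every initial interval $I$ of $P$ equals $I_n$ for some $n$. * A rational number is (the code of) a fraction in lowest terms. $P$ is scattered if there is no (graph of a) function $f\colon\mathbb Q\to P$ such that $q\leq r\iff f(q)\preceq f(r)$ for all $q,r\in\mathbb Q$. **Theorem.** $\mathsf{RCA}_0$ proves that every partial order with countably many initial intervals is scattered. That is, the $L_2$-sentence "for every partial order $(P,\preceq)$, if $P$ has countably many initial intervals, then $P$ is scattered" is a logical consequence of $\mathsf{RCA}_0$: it is true in every $L_2$-structure that satisfies $\mathsf{RCA}_0$ (equivalently, by the completeness theorem, it is formally deducible from $\mathsf{RCA}_0$). -/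

import Mathlib

universe u

/-! ## Two-sorted language of second order arithmetic -/

namespace SecondOrderArithmetic

/-- Numerical terms of the language of second order arithmetic, in the number variables
`x₀, …, xₙ₋₁`. -/
inductive Term (n : ℕ) : Type
  | var (i : Fin n) : Term n
  | zero : Term n
  | one : Term n
  | add (s t : Term n) : Term n
  | mul (s t : Term n) : Term n

instance (n : ℕ) : Zero (Term n) := ⟨Term.zero⟩
instance (n : ℕ) : One (Term n) := ⟨Term.one⟩
instance (n : ℕ) : Add (Term n) := ⟨Term.add⟩
instance (n : ℕ) : Mul (Term n) := ⟨Term.mul⟩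

/-- Formulas with free number variables among `x₀, …, xₙ₋₁` and free set variables among
`X₀, …, Xₖ₋₁`. A number quantifier in front of a formula with number variables `x₀, …, xₙ` binds
the last one, `xₙ`; a set quantifier binds the last set variable. Equality of sets is not
primitive: it abbreviates having the same elements. -/
inductive Formula : ℕ → ℕ → Type
  | eq {n k : ℕ} (s t : Term n) : Formula n k
  | lt {n k : ℕ} (s t : Term n) : Formula n k
  | mem {n k : ℕ} (t : Term n) (X : Fin k) : Formula n k
  | not {n k : ℕ} (φ : Formula n k) : Formula n k
  | and {n k : ℕ} (φ ψ : Formula n k) : Formula n k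
  | or {n k : ℕ} (φ ψ : Formula n k) : Formula n k
  | imp {n k : ℕ} (φ ψ : Formula n k) : Formula n k
  | all {n k : ℕ} (φ : Formula (n + 1) k) : Formula n k
  | ex {n k : ℕ} (φ : Formula (n + 1) k) : Formula n k
  | allSet {n k : ℕ} (φ : Formula n (k + 1)) : Formula n k
  | exSet {n k : ℕ} (φ : Formula n (k + 1)) : Formula n k

/-- Formulas without free variables. -/
abbrev Sentence : Type := Formula 0 0

prefix:max "𝓍" => Term.var
infix:62 " ≐ " => Formula.eq
infix:62 " ≺ₙ " => Formula.lt
infix:62 " ∈ₛ " => Formula.mem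
infixr:60 " ⋏ " => Formula.and
infixr:58 " ⋎ " => Formula.or
infixr:55 " ⇒ " => Formula.imp

/-- Equivalence of formulas. -/
def Formula.iff {n k : ℕ} (φ ψ : Formula n k) : Formula n k := (φ ⇒ ψ) ⋏ (ψ ⇒ φ)

infix:53 " ⇔ " => Formula.iff

/-- Simultaneous substitution of terms for number variables in a term. -/
def Term.subst {n m : ℕ} (σ : Fin n → Term m) : Term n → Term m
  | .var i => σ i
  | .zero => .zero
  | .one => .one
  | .add s t => .add (s.subst σ) (t.subst σ)
  | .mul s t => .mul (s.subst σ) (t.subst σ)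

/-- View a term in `x₀, …, xₙ₋₁` as a term in `x₀, …, xₙ₊ₘ₋₁`. -/
def Term.lift {n : ℕ} (m : ℕ) (t : Term n) : Term (n + m) :=
  t.subst fun i => .var (Fin.castAdd m i)

/-- The variable `xₙ₊ᵢ`, the `i`-th of `m` variables added to `x₀, …, xₙ₋₁`. -/
def Term.new (n m : ℕ) (i : Fin m) : Term (n + m) := .var (Fin.natAdd n i)

/-- Capture-free simultaneous substitution of terms for the free number variables, and of set
variables for the free set variables, in a formula. -/
def Formula.subst : {n k m l : ℕ} → (Fin n → Term m) → (Fin k → Fin l) →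
    Formula n k → Formula m l
  | _, _, _, _, σ, _, .eq s t => .eq (s.subst σ) (t.subst σ)
  | _, _, _, _, σ, _, .lt s t => .lt (s.subst σ) (t.subst σ)
  | _, _, _, _, σ, ρ, .mem t X => .mem (t.subst σ) (ρ X)
  | _, _, _, _, σ, ρ, .not φ => .not (φ.subst σ ρ)
  | _, _, _, _, σ, ρ, .and φ ψ => .and (φ.subst σ ρ) (ψ.subst σ ρ)
  | _, _, _, _, σ, ρ, .or φ ψ => .or (φ.subst σ ρ) (ψ.subst σ ρ)
  | _, _, _, _, σ, ρ, .imp φ ψ => .imp (φ.subst σ ρ) (ψ.subst σ ρ)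
  | _, _, m, _, σ, ρ, .all φ =>
      .all (φ.subst (Fin.snoc (fun i => (σ i).lift 1) (.var (Fin.last m))) ρ)
  | _, _, m, _, σ, ρ, .ex φ =>
      .ex (φ.subst (Fin.snoc (fun i => (σ i).lift 1) (.var (Fin.last m))) ρ)
  | _, _, _, l, σ, ρ, .allSet φ =>
      .allSet (φ.subst σ (Fin.snoc (fun i => (ρ i).castSucc) (Fin.last l)))
  | _, _, _, l, σ, ρ, .exSet φ =>
      .exSet (φ.subst σ (Fin.snoc (fun i => (ρ i).castSucc) (Fin.last l)))

/-- `φ(0)`, where `φ` is regarded as a formula `φ(xₙ)` with the other variables as parameters. -/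
def Formula.atZero {n k : ℕ} (φ : Formula (n + 1) k) : Formula n k :=
  φ.subst (Fin.snoc (fun i => .var i) 0) id

/-- `φ(xₙ + 1)`, where `φ` is regarded as a formula `φ(xₙ)` with the other variables as
parameters. -/
def Formula.atSucc {n k : ℕ} (φ : Formula (n + 1) k) : Formula (n + 1) k :=
  φ.subst (Fin.snoc (fun i => .var i.castSucc) (.var (Fin.last n) + 1)) id

/-- The same formula, in the context of one more set variable `Xₖ`, which is not free in it. -/
def Formula.liftSet {n k : ℕ} (φ : Formula n k) : Formula n (k + 1) :=
  φ.subst (fun i => .var i) Fin.castSucc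

/-- Universal quantification over all free number variables. -/
def Formula.closeNum {k : ℕ} : {n : ℕ} → Formula n k → Formula 0 k
  | 0, φ => φ
  | _ + 1, φ => Formula.closeNum (.all φ)

/-- Universal quantification over all free set variables. -/
def Formula.closeSet : {k : ℕ} → Formula 0 k → Sentence
  | 0, φ => φ
  | _ + 1, φ => Formula.closeSet (.allSet φ)

/-- The universal closure of a formula. -/
def Formula.close {n k : ℕ} (φ : Formula n k) : Sentence := φ.closeNum.closeSet

/-! ## Semantics -/

/-- Structures for the language of second order arithmetic: a possibly nonstandard number part
`Num`, and a collection `Sets` of subsets of `Num` over which the set variables range. -/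
structure L2Structure : Type (u + 1) where
  Num : Type u
  zero : Num
  one : Num
  add : Num → Num → Num
  mul : Num → Num → Num
  lt : Num → Num → Prop
  Sets : Set (Set Num)

/-- The value of a term. -/
def Term.eval (M : L2Structure.{u}) {n : ℕ} (v : Fin n → M.Num) : Term n → M.Num
  | .var i => v i
  | .zero => M.zero
  | .one => M.one
  | .add s t => M.add (s.eval M v) (t.eval M v)
  | .mul s t => M.mul (s.eval M v) (t.eval M v)

/-- Truth of a formula under an assignment of numbers and of sets to its variables. -/
def Formula.Realize (M : L2Structure.{u}) : {n k : ℕ} → Formula n k →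
    (Fin n → M.Num) → (Fin k → M.Sets) → Prop
  | _, _, .eq s t, v, _ => s.eval M v = t.eval M v
  | _, _, .lt s t, v, _ => M.lt (s.eval M v) (t.eval M v)
  | _, _, .mem t X, v, V => t.eval M v ∈ (V X : Set M.Num)
  | _, _, .not φ, v, V => ¬ φ.Realize M v V
  | _, _, .and φ ψ, v, V => φ.Realize M v V ∧ ψ.Realize M v V
  | _, _, .or φ ψ, v, V => φ.Realize M v V ∨ ψ.Realize M v V
  | _, _, .imp φ ψ, v, V => φ.Realize M v V → ψ.Realize M v V
  | n, _, .all φ, v, V => ∀ a : M.Num, φ.Realize M (Fin.snoc (n := n) (α := fun _ => M.Num) v a) V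
  | n, _, .ex φ, v, V => ∃ a : M.Num, φ.Realize M (Fin.snoc (n := n) (α := fun _ => M.Num) v a) V
  | _, k, .allSet φ, v, V =>
      ∀ A : M.Sets, φ.Realize M v (Fin.snoc (n := k) (α := fun _ => M.Sets) V A)
  | _, k, .exSet φ, v, V =>
      ∃ A : M.Sets, φ.Realize M v (Fin.snoc (n := k) (α := fun _ => M.Sets) V A)

/-- Truth of a sentence in a structure. -/
def L2Structure.Satisfies (M : L2Structure.{u}) (φ : Sentence) : Prop :=
  φ.Realize M Fin.elim0 Fin.elim0

/-- `φ` is a theorem of the axiom system `T`: it is a logical consequence of `T`, that is, it is true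
in every structure (with possibly nonstandard number part and arbitrary set part) in which all the
axioms of `T` are true. By the completeness theorem for two-sorted first order logic this is the
same as being formally deducible from `T`. -/
def Entails (T : Set Sentence) (φ : Sentence) : Prop :=
  ∀ M : L2Structure.{u}, (∀ ψ ∈ T, M.Satisfies ψ) → M.Satisfies φ

/-! ## The axioms of `RCA₀` -/

/-- Bounded quantifier formulas: no set quantifiers, and number quantifiers only in the forms
`∀ xₙ (xₙ < t → …)` and `∃ xₙ (xₙ < t ∧ …)`, where `xₙ` does not occur in the term `t`. -/
inductive Formula.IsBounded : {n k : ℕ} → Formula n k → Prop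
  | eq {n k : ℕ} (s t : Term n) : IsBounded (Formula.eq (k := k) s t)
  | lt {n k : ℕ} (s t : Term n) : IsBounded (Formula.lt (k := k) s t)
  | mem {n k : ℕ} (t : Term n) (X : Fin k) : IsBounded (Formula.mem t X)
  | not {n k : ℕ} {φ : Formula n k} : IsBounded φ → IsBounded (Formula.not φ)
  | and {n k : ℕ} {φ ψ : Formula n k} : IsBounded φ → IsBounded ψ → IsBounded (φ ⋏ ψ)
  | or {n k : ℕ} {φ ψ : Formula n k} : IsBounded φ → IsBounded ψ → IsBounded (φ ⋎ ψ)
  | imp {n k : ℕ} {φ ψ : Formula n k} : IsBounded φ → IsBounded ψ → IsBounded (φ ⇒ ψ)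
  | ball {n k : ℕ} (t : Term n) {φ : Formula (n + 1) k} : IsBounded φ →
      IsBounded (Formula.all (𝓍 (Fin.last n) ≺ₙ t.lift 1 ⇒ φ))
  | bex {n k : ℕ} (t : Term n) {φ : Formula (n + 1) k} : IsBounded φ →
      IsBounded (Formula.ex (𝓍 (Fin.last n) ≺ₙ t.lift 1 ⋏ φ))

/-- `Σ⁰₁` formulas (set parameters are allowed). -/
def Formula.IsSigma1 {n k : ℕ} (φ : Formula n k) : Prop :=
  ∃ θ : Formula (n + 1) k, θ.IsBounded ∧ φ = .ex θ

/-- `Π⁰₁` formulas (set parameters are allowed). -/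
def Formula.IsPi1 {n k : ℕ} (φ : Formula n k) : Prop :=
  ∃ θ : Formula (n + 1) k, θ.IsBounded ∧ φ = .all θ

/-- The basic axioms of arithmetic, before universal closure. -/
def basicAxioms : Set (Formula 2 0) :=
  { .not (𝓍 0 + 1 ≐ 0),
    𝓍 0 + 1 ≐ 𝓍 1 + 1 ⇒ 𝓍 0 ≐ 𝓍 1,
    𝓍 0 + 0 ≐ 𝓍 0,
    𝓍 0 + (𝓍 1 + 1) ≐ (𝓍 0 + 𝓍 1) + 1,
    𝓍 0 * 0 ≐ 0,
    𝓍 0 * (𝓍 1 + 1) ≐ 𝓍 0 * 𝓍 1 + 𝓍 0,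
    .not (𝓍 0 ≺ₙ 0),
    𝓍 0 ≺ₙ 𝓍 1 + 1 ⇔ (𝓍 0 ≺ₙ 𝓍 1 ⋎ 𝓍 0 ≐ 𝓍 1) }

/-- `(φ(0) ∧ ∀ x (φ(x) → φ(x + 1))) → ∀ x φ(x)`. -/
def inductionAxiom {n k : ℕ} (φ : Formula (n + 1) k) : Formula n k :=
  (φ.atZero ⋏ .all (φ ⇒ φ.atSucc)) ⇒ .all φ

/-- `∀ x (φ(x) ↔ ψ(x)) → ∃ X ∀ x (x ∈ X ↔ φ(x))`, with `X` not free in `φ`. -/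
def comprehensionAxiom {n k : ℕ} (φ ψ : Formula (n + 1) k) : Formula n k :=
  .all (φ ⇔ ψ) ⇒ .exSet (.all (𝓍 (Fin.last n) ∈ₛ Fin.last k ⇔ φ.liftSet))

/-- The axiom system `RCA₀`: the basic axioms, `Σ⁰₁` induction and `Δ⁰₁` comprehension, with
arbitrary number and set parameters. -/
def RCA₀ : Set Sentence :=
  { χ | (∃ φ ∈ basicAxioms, χ = φ.close) ∨
    (∃ (n k : ℕ) (φ : Formula (n + 1) k), φ.IsSigma1 ∧ χ = (inductionAxiom φ).close) ∨
    (∃ (n k : ℕ) (φ ψ : Formula (n + 1) k),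
      φ.IsSigma1 ∧ ψ.IsPi1 ∧ χ = (comprehensionAxiom φ ψ).close) }

/-! ## Partial orders in second order arithmetic -/

/-- The usual code `(s + t)² + s` of the ordered pair `(s, t)`. -/
def pair {n : ℕ} (s t : Term n) : Term n := (s + t) * (s + t) + s

/-- `(P, ≼)` is a partial order: `P` is a set of numbers and `≼`, given by the set `R` of codes of
pairs, is a reflexive, antisymmetric and transitive relation contained in `P × P`. -/
def partialOrder {k : ℕ} (P R : Fin k) : Formula 0 k :=
  .all (𝓍 0 ∈ₛ R ⇒ .ex (.ex (𝓍 0 ≐ pair (𝓍 1) (𝓍 2) ⋏ 𝓍 1 ∈ₛ P ⋏ 𝓍 2 ∈ₛ P))) ⋏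
  .all (𝓍 0 ∈ₛ P ⇒ pair (𝓍 0) (𝓍 0) ∈ₛ R) ⋏
  .all (.all (pair (𝓍 0) (𝓍 1) ∈ₛ R ⋏ pair (𝓍 1) (𝓍 0) ∈ₛ R ⇒ 𝓍 0 ≐ 𝓍 1)) ⋏
  .all (.all (.all (pair (𝓍 0) (𝓍 1) ∈ₛ R ⋏ pair (𝓍 1) (𝓍 2) ∈ₛ R ⇒ pair (𝓍 0) (𝓍 2) ∈ₛ R)))

/-- `I` is an initial interval of `(P, ≼)`. -/
def initialInterval {k : ℕ} (P R I : Fin k) : Formula 0 k :=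
  .all (𝓍 0 ∈ₛ I ⇒ 𝓍 0 ∈ₛ P) ⋏
  .all (.all (𝓍 0 ∈ₛ P ⋏ 𝓍 1 ∈ₛ P ⋏ pair (𝓍 0) (𝓍 1) ∈ₛ R ⋏ 𝓍 1 ∈ₛ I ⇒ 𝓍 0 ∈ₛ I))

/-- `(P, ≼)` has countably many initial intervals: there is a set `Z`, coding the sequence of the
sets `Iₙ = {x | (n, x) ∈ Z}`, such that every initial interval of `(P, ≼)` is equal to some
`Iₙ`. -/
def countablyManyInitialIntervals {k : ℕ} (P R : Fin k) : Formula 0 k :=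
  .exSet (.allSet
    (initialInterval P.castSucc.castSucc R.castSucc.castSucc (Fin.last (k + 1)) ⇒
      .ex (.all (𝓍 1 ∈ₛ Fin.last (k + 1) ⇔ pair (𝓍 0) (𝓍 1) ∈ₛ (Fin.last k).castSucc))))

/-- `s ≤ t`. -/
def le {n k : ℕ} (s t : Term n) : Formula n k := s ≺ₙ t ⋎ s ≐ t

/-- `s` divides `t`. -/
def divides {n k : ℕ} (s t : Term n) : Formula n k := .ex (s.lift 1 * Term.new n 1 0 ≐ t.lift 1)

/-- The code of the fraction `(a - b) / d`. -/
def fraction {n : ℕ} (a b d : Term n) : Term n := pair (pair a b) d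

/-- The fraction `(a - b) / d` is in lowest terms: one of `a`, `b` is `0`, so that `a + b` is the
absolute value of the numerator, and `d` is positive and has no common factor with it. -/
def lowestTerms {n k : ℕ} (a b d : Term n) : Formula n k :=
  (a ≐ 0 ⋎ b ≐ 0) ⋏ 0 ≺ₙ d ⋏
  .all (divides (Term.new n 1 0) ((a + b).lift 1) ⋏ divides (Term.new n 1 0) (d.lift 1) ⇒
    Term.new n 1 0 ≐ 1)

/-- `q` is (the code of) a rational number, that is, of a fraction in lowest terms. -/
def rational {n k : ℕ} (q : Term n) : Formula n k :=
  .ex (.ex (.ex (q.lift 3 ≐ fraction (Term.new n 3 0) (Term.new n 3 1) (Term.new n 3 2) ⋏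
    lowestTerms (n := n + 3) (Term.new n 3 0) (Term.new n 3 1) (Term.new n 3 2))))

/-- `q ≤ r` for rational numbers `q = (a - b) / d` and `r = (a' - b') / d'`, that is,
`a d' + b' d ≤ a' d + b d'`. -/
def rationalLe {n k : ℕ} (q r : Term n) : Formula n k :=
  .ex (.ex (.ex (.ex (.ex (.ex (
    q.lift 6 ≐ fraction (Term.new n 6 0) (Term.new n 6 1) (Term.new n 6 2) ⋏
    r.lift 6 ≐ fraction (Term.new n 6 3) (Term.new n 6 4) (Term.new n 6 5) ⋏
    le (n := n + 6) (Term.new n 6 0 * Term.new n 6 5 + Term.new n 6 4 * Term.new n 6 2)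
      (Term.new n 6 3 * Term.new n 6 2 + Term.new n 6 1 * Term.new n 6 5)))))))

/-- `F` is (the set of codes of the pairs in the graph of) a function from the rational numbers to
`P` such that `q ≤ r` if and only if `F(q) ≼ F(r)`, for all rational numbers `q` and `r`. -/
def embeddingOfRationals {k : ℕ} (P R F : Fin k) : Formula 0 k :=
  .all (𝓍 0 ∈ₛ F ⇒ .ex (.ex (𝓍 0 ≐ pair (𝓍 1) (𝓍 2) ⋏ rational (𝓍 1) ⋏ 𝓍 2 ∈ₛ P))) ⋏
  .all (rational (𝓍 0) ⇒ .ex (pair (𝓍 0) (𝓍 1) ∈ₛ F)) ⋏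
  .all (.all (.all (pair (𝓍 0) (𝓍 1) ∈ₛ F ⋏ pair (𝓍 0) (𝓍 2) ∈ₛ F ⇒ 𝓍 1 ≐ 𝓍 2))) ⋏
  .all (.all (.all (.all (pair (𝓍 0) (𝓍 2) ∈ₛ F ⋏ pair (𝓍 1) (𝓍 3) ∈ₛ F ⇒
    (rationalLe (𝓍 0) (𝓍 1) ⇔ pair (𝓍 2) (𝓍 3) ∈ₛ R)))))

/-- `(P, ≼)` is scattered: the order of the rational numbers does not embed into it. -/
def scattered {k : ℕ} (P R : Fin k) : Formula 0 k :=
  .not (.exSet (embeddingOfRationals P.castSucc R.castSucc (Fin.last k)))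

/-- The sentence: every partial order with countably many initial intervals is scattered. -/
def countablyManyImpliesScattered : Sentence :=
  .allSet (.allSet
    (partialOrder 0 1 ⋏ countablyManyInitialIntervals 0 1 ⇒ scattered 0 1))

end SecondOrderArithmetic

/-! Suppose that `f : ℚ → P` is an embedding and that `Z` lists the initial intervals. A real number
`α` gives the initial interval `I = {x | x ≼ f(q) for some q < α}`, and a diagonal choice of `α`
makes `I` differ from every listed set. The difficulty is that `I` is a priori only `Σ⁰₁`, hence
need not be a set of the model. So `α` is also made generic: for each `x`, either some rational
below `α` satisfies `x ≼ f(q)`, or some rational above `α` fails it. As this property of `q` is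
upward closed, `I` is then also the set of `x` with `x ≼ f(r)` for every right end point `r` of an
interval approximating `α`, and `Δ⁰₁` comprehension yields `I`.

Both kinds of demand have one form: find an approximating interval whose left end point has the
`e`-th property or whose right end point lacks it. For `e = 2x` the property is `x ≼ f(q)`, for `e =
2n + 1` it is `f(q) ∉ Iₙ`. If an interval does not meet demand `e`, passing to one of its two parts
does: the mediant becomes the left end point if it has the property, and the right end point
otherwise (`meets_child`).

The approximating intervals are those of the Stern–Brocot tree. All intervals of the tree containing
a given one are bounded by its size (`Within.size_le`), and those containing a child are the child
and the ones containing its parent (`within_of_upper_within`, `within_of_lower_within`). Hence lying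
on the path is a bounded condition, with no coding of sequences, and `Σ⁰₁` induction shows that the
path goes on and meets each demand (`exists_onPath_meets`). The contradiction is drawn in
`not_isEmbeddingOfRationals`. -/

namespace SecondOrderArithmetic

/-! ## Substitution and universal closure -/

section Semantics

variable {M : L2Structure.{u}}

theorem Term.eval_subst {n m : ℕ} (σ : Fin n → Term m) (v : Fin m → M.Num) (t : Term n) :
    (t.subst σ).eval M v = t.eval M fun i => (σ i).eval M v := by
  induction t with
  | var i => rfl
  | zero => rfl
  | one => rfl
  | add s t hs ht => simp only [Term.subst, Term.eval, hs, ht]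
  | mul s t hs ht => simp only [Term.subst, Term.eval, hs, ht]

theorem Term.eval_lift {n : ℕ} (v : Fin n → M.Num) (a : M.Num) (t : Term n) :
    (t.lift 1).eval M (Fin.snoc (n := n) (α := fun _ => M.Num) v a) = t.eval M v := by
  rw [Term.lift, Term.eval_subst]
  congr 1
  funext i
  exact Fin.snoc_castSucc (α := fun _ => M.Num) a v i

/-- The quantifier step for substitution: the bound variable is sent to itself, the other terms are
weakened and do not see its value. -/
theorem eval_snoc_lift {n m : ℕ} (σ : Fin n → Term m) (v : Fin m → M.Num) (a : M.Num) :
    (fun i => Term.eval M (Fin.snoc (n := m) (α := fun _ => M.Num) v a)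
      ((Fin.snoc (n := n) (α := fun _ => Term (m + 1)) (fun i => (σ i).lift 1)
        (.var (Fin.last m)) : Fin (n + 1) → Term (m + 1)) i)) =
      Fin.snoc (n := n) (α := fun _ => M.Num) (fun i => (σ i).eval M v) a := by
  funext i
  refine Fin.lastCases ?_ (fun i => ?_) i
  · simp [Term.eval]
  · simp [Term.eval_lift]

theorem snoc_comp_snoc {k l : ℕ} (ρ : Fin k → Fin l) (V : Fin l → M.Sets) (A : M.Sets) :
    (fun i => Fin.snoc (n := l) (α := fun _ => M.Sets) V A
      ((Fin.snoc (n := k) (α := fun _ => Fin (l + 1)) (fun i => (ρ i).castSucc)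
        (Fin.last l) : Fin (k + 1) → Fin (l + 1)) i)) =
      Fin.snoc (n := k) (α := fun _ => M.Sets) (fun i => V (ρ i)) A := by
  funext i
  refine Fin.lastCases ?_ (fun i => ?_) i <;> simp

theorem Formula.realize_subst {n k : ℕ} (φ : Formula n k) : ∀ {m l : ℕ} (σ : Fin n → Term m)
    (ρ : Fin k → Fin l) (v : Fin m → M.Num) (V : Fin l → M.Sets),
    (φ.subst σ ρ).Realize M v V ↔ φ.Realize M (fun i => (σ i).eval M v) fun i => V (ρ i) := by
  induction φ with
  | eq s t => intros; simp only [Formula.subst, Formula.Realize, Term.eval_subst]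
  | lt s t => intros; simp only [Formula.subst, Formula.Realize, Term.eval_subst]
  | mem t X => intros; simp only [Formula.subst, Formula.Realize, Term.eval_subst]
  | not φ h => intros; simp only [Formula.subst, Formula.Realize, h]
  | and φ ψ h h' => intros; simp only [Formula.subst, Formula.Realize, h, h']
  | or φ ψ h h' => intros; simp only [Formula.subst, Formula.Realize, h, h']
  | imp φ ψ h h' => intros; simp only [Formula.subst, Formula.Realize, h, h']
  | all φ h => intros; simp only [Formula.subst, Formula.Realize, h, eval_snoc_lift]
  | ex φ h => intros; simp only [Formula.subst, Formula.Realize, h, eval_snoc_lift]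
  | allSet φ h => intros; simp only [Formula.subst, Formula.Realize, h, snoc_comp_snoc]
  | exSet φ h => intros; simp only [Formula.subst, Formula.Realize, h, snoc_comp_snoc]

theorem Formula.realize_closeNum {n k : ℕ} (φ : Formula n k) (V : Fin k → M.Sets) :
    φ.closeNum.Realize M Fin.elim0 V ↔ ∀ v, φ.Realize M v V := by
  induction n with
  | zero => exact ⟨fun h v => by rwa [Subsingleton.elim v Fin.elim0], fun h => h _⟩
  | succ n ih =>
    refine (ih (.all φ)).trans ⟨fun h v => ?_, fun h v a => h _⟩
    have := h (Fin.init v) (v (Fin.last n))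
    rwa [Fin.snoc_init_self] at this

theorem Formula.realize_closeSet {k : ℕ} (φ : Formula 0 k) :
    M.Satisfies φ.closeSet ↔ ∀ V, φ.Realize M Fin.elim0 V := by
  induction k with
  | zero => exact ⟨fun h V => by rwa [Subsingleton.elim V Fin.elim0], fun h => h _⟩
  | succ k ih =>
    refine (ih (.allSet φ)).trans ⟨fun h V => ?_, fun h V A => h _⟩
    have := h (Fin.init V) (V (Fin.last k))
    rwa [Fin.snoc_init_self] at this

theorem satisfies_close {n k : ℕ} (φ : Formula n k) :
    M.Satisfies φ.close ↔ ∀ v V, φ.Realize M v V := by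
  rw [Formula.close, Formula.realize_closeSet]
  simp only [Formula.realize_closeNum]
  exact forall_comm

theorem Formula.realize_atZero {n k : ℕ} (φ : Formula (n + 1) k) (v : Fin n → M.Num)
    (V : Fin k → M.Sets) :
    φ.atZero.Realize M v V ↔
      φ.Realize M (Fin.snoc (n := n) (α := fun _ => M.Num) v M.zero) V := by
  rw [Formula.atZero, Formula.realize_subst]
  refine iff_of_eq (congrArg₂ _ (funext fun i => ?_) rfl)
  refine Fin.lastCases ?_ (fun i => ?_) i
  · simp only [Fin.snoc_last]; rfl
  · simp [Term.eval]

theorem Formula.realize_atSucc {n k : ℕ} (φ : Formula (n + 1) k) (v : Fin n → M.Num)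
    (a : M.Num) (V : Fin k → M.Sets) :
    φ.atSucc.Realize M (Fin.snoc (n := n) (α := fun _ => M.Num) v a) V ↔
      φ.Realize M (Fin.snoc (n := n) (α := fun _ => M.Num) v (M.add a M.one)) V := by
  rw [Formula.atSucc, Formula.realize_subst]
  refine iff_of_eq (congrArg₂ _ (funext fun i => ?_) rfl)
  refine Fin.lastCases ?_ (fun i => ?_) i
  · simp only [Fin.snoc_last]
    show M.add (Fin.snoc (n := n) (α := fun _ => M.Num) v a (Fin.last n)) M.one = _
    simp
  · simp [Term.eval]

theorem Formula.realize_liftSet {n k : ℕ} (φ : Formula n k) (v : Fin n → M.Num)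
    (V : Fin k → M.Sets) (A : M.Sets) :
    φ.liftSet.Realize M v (Fin.snoc (n := k) (α := fun _ => M.Sets) V A) ↔
      φ.Realize M v V := by
  rw [Formula.liftSet, Formula.realize_subst]
  refine iff_of_eq (congrArg₂ _ rfl (funext fun i => ?_))
  simp

end Semantics

/-! ## Predicates definable by bounded formulas -/

section Definability

variable (M : L2Structure.{u})

instance : Zero M.Num := ⟨M.zero⟩
instance : One M.Num := ⟨M.one⟩
instance : Add M.Num := ⟨M.add⟩
instance : Mul M.Num := ⟨M.mul⟩
instance : LT M.Num := ⟨M.lt⟩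

/-- Iterated products `Unit × M.Num × … × M.Num`, as types of assignments. An assignment in `Γ` can
be put behind any tuple of parameters. -/
class Context (Γ : Type u) where
  length : ℕ
  assign : {m : ℕ} → (Fin m → M.Num) → Γ → Fin (m + length) → M.Num
  assign_param : ∀ {m : ℕ} (p : Fin m → M.Num) (i : Fin m), ∃ j, ∀ γ, assign p γ j = p i

instance : Context M PUnit.{u + 1} where
  length := 0
  assign := fun p _ => p
  assign_param _ i := ⟨i, fun _ => rfl⟩

instance {Γ : Type u} [Context M Γ] : Context M (Γ × M.Num) where
  length := Context.length M Γ + 1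
  assign {m} p γ := Fin.snoc (n := m + Context.length M Γ) (α := fun _ => M.Num)
    (Context.assign p γ.1) γ.2
  assign_param {m} p i := by
    obtain ⟨j, hj⟩ := Context.assign_param (M := M) (Γ := Γ) p i
    refine ⟨j.castSucc, fun γ => ?_⟩
    rw [← hj γ.1]
    exact Fin.snoc_castSucc (α := fun _ => M.Num) _ _ _

variable {M} {Γ : Type u} [Context M Γ]

/-- `f` is given by a term, with parameters from `M`. -/
class TermDefinable (f : Γ → M.Num) : Prop where
  out : ∃ s : Finset M.Num, ∀ (m : ℕ) (p : Fin m → M.Num), (∀ a ∈ s, ∃ i, p i = a) →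
    ∃ t : Term (m + Context.length M Γ), ∀ γ, t.eval M (Context.assign p γ) = f γ

/-- `R` is given by a bounded formula, with number and set parameters from `M`. -/
class BoundedDefinable (R : Γ → Prop) : Prop where
  out : ∃ (s : Finset M.Num) (S : Finset M.Sets), ∀ (m k : ℕ) (p : Fin m → M.Num)
    (V : Fin k → M.Sets), (∀ a ∈ s, ∃ i, p i = a) → (∀ A ∈ S, ∃ i, V i = A) →
    ∃ φ : Formula (m + Context.length M Γ) k, φ.IsBounded ∧
      ∀ γ, φ.Realize M (Context.assign p γ) V ↔ R γ

instance TermDefinable.const (a : M.Num) : TermDefinable fun _ : Γ => a := by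
  refine ⟨{a}, fun m p hp => ?_⟩
  obtain ⟨i, rfl⟩ := hp a (by simp)
  obtain ⟨j, hj⟩ := Context.assign_param (M := M) (Γ := Γ) p i
  exact ⟨.var j, hj⟩

instance TermDefinable.var₀ : TermDefinable fun γ : Γ × M.Num => γ.2 :=
  ⟨∅, fun m _ _ => ⟨.var (Fin.last (m + Context.length M Γ)), fun _ =>
    Fin.snoc_last (α := fun _ => M.Num) _ _⟩⟩

theorem TermDefinable.comp_fst (f : Γ → M.Num) [hf : TermDefinable f] :
    TermDefinable fun γ : Γ × M.Num => f γ.1 := by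
  obtain ⟨s, hs⟩ := hf.out
  refine ⟨s, fun m p hp => ?_⟩
  obtain ⟨t, ht⟩ := hs m p hp
  exact ⟨t.lift 1, fun γ => (Term.eval_lift _ _ _).trans (ht γ.1)⟩

instance TermDefinable.comp₁ (f : Γ → M.Num) [TermDefinable f] :
    TermDefinable fun γ : Γ × M.Num => f γ.1 := comp_fst f

instance TermDefinable.comp₂ (f : Γ → M.Num) [TermDefinable f] :
    TermDefinable fun γ : (Γ × M.Num) × M.Num => f γ.1.1 := comp_fst fun γ : Γ × M.Num => f γ.1

instance TermDefinable.comp₃ (f : Γ → M.Num) [TermDefinable f] :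
    TermDefinable fun γ : ((Γ × M.Num) × M.Num) × M.Num => f γ.1.1.1 :=
  comp_fst fun γ : (Γ × M.Num) × M.Num => f γ.1.1

instance TermDefinable.comp₄ (f : Γ → M.Num) [TermDefinable f] :
    TermDefinable fun γ : (((Γ × M.Num) × M.Num) × M.Num) × M.Num => f γ.1.1.1.1 :=
  comp_fst fun γ : ((Γ × M.Num) × M.Num) × M.Num => f γ.1.1.1

instance TermDefinable.var₁ : TermDefinable fun γ : (Γ × M.Num) × M.Num => γ.1.2 :=
  comp_fst fun γ : Γ × M.Num => γ.2

instance TermDefinable.var₂ : TermDefinable fun γ : ((Γ × M.Num) × M.Num) × M.Num => γ.1.1.2 :=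
  comp_fst fun γ : (Γ × M.Num) × M.Num => γ.1.2

instance TermDefinable.var₃ :
    TermDefinable fun γ : (((Γ × M.Num) × M.Num) × M.Num) × M.Num => γ.1.1.1.2 :=
  comp_fst fun γ : ((Γ × M.Num) × M.Num) × M.Num => γ.1.1.2

instance TermDefinable.var₄ :
    TermDefinable fun γ : ((((Γ × M.Num) × M.Num) × M.Num) × M.Num) × M.Num => γ.1.1.1.1.2 :=
  comp_fst fun γ : (((Γ × M.Num) × M.Num) × M.Num) × M.Num => γ.1.1.1.2

instance TermDefinable.var₅ :
    TermDefinable fun γ : (((((Γ × M.Num) × M.Num) × M.Num) × M.Num) × M.Num) × M.Num =>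
      γ.1.1.1.1.1.2 :=
  comp_fst fun γ : ((((Γ × M.Num) × M.Num) × M.Num) × M.Num) × M.Num => γ.1.1.1.1.2

instance TermDefinable.zero : TermDefinable fun _ : Γ => (0 : M.Num) := const 0

instance TermDefinable.one : TermDefinable fun _ : Γ => (1 : M.Num) := const 1

instance TermDefinable.add (f g : Γ → M.Num) [hf : TermDefinable f] [hg : TermDefinable g] :
    TermDefinable fun γ => f γ + g γ := by
  classical
  obtain ⟨s, hs⟩ := hf.out
  obtain ⟨s', hs'⟩ := hg.out
  refine ⟨s ∪ s', fun m p hp => ?_⟩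
  obtain ⟨t, ht⟩ := hs m p fun a ha => hp a (Finset.mem_union_left _ ha)
  obtain ⟨t', ht'⟩ := hs' m p fun a ha => hp a (Finset.mem_union_right _ ha)
  exact ⟨.add t t', fun γ => congrArg₂ M.add (ht γ) (ht' γ)⟩

instance TermDefinable.mul (f g : Γ → M.Num) [hf : TermDefinable f] [hg : TermDefinable g] :
    TermDefinable fun γ => f γ * g γ := by
  classical
  obtain ⟨s, hs⟩ := hf.out
  obtain ⟨s', hs'⟩ := hg.out
  refine ⟨s ∪ s', fun m p hp => ?_⟩
  obtain ⟨t, ht⟩ := hs m p fun a ha => hp a (Finset.mem_union_left _ ha)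
  obtain ⟨t', ht'⟩ := hs' m p fun a ha => hp a (Finset.mem_union_right _ ha)
  exact ⟨.mul t t', fun γ => congrArg₂ M.mul (ht γ) (ht' γ)⟩

instance BoundedDefinable.eq (f g : Γ → M.Num) [hf : TermDefinable f] [hg : TermDefinable g] :
    BoundedDefinable (M := M) fun γ => f γ = g γ := by
  classical
  obtain ⟨s, hs⟩ := hf.out
  obtain ⟨s', hs'⟩ := hg.out
  refine ⟨s ∪ s', ∅, fun m k p V hp _ => ?_⟩
  obtain ⟨t, ht⟩ := hs m p fun a ha => hp a (Finset.mem_union_left _ ha)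
  obtain ⟨t', ht'⟩ := hs' m p fun a ha => hp a (Finset.mem_union_right _ ha)
  exact ⟨.eq t t', .eq _ _, fun γ => by rw [Formula.Realize, ht, ht']⟩

instance BoundedDefinable.lt (f g : Γ → M.Num) [hf : TermDefinable f] [hg : TermDefinable g] :
    BoundedDefinable (M := M) fun γ => f γ < g γ := by
  classical
  obtain ⟨s, hs⟩ := hf.out
  obtain ⟨s', hs'⟩ := hg.out
  refine ⟨s ∪ s', ∅, fun m k p V hp _ => ?_⟩
  obtain ⟨t, ht⟩ := hs m p fun a ha => hp a (Finset.mem_union_left _ ha)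
  obtain ⟨t', ht'⟩ := hs' m p fun a ha => hp a (Finset.mem_union_right _ ha)
  exact ⟨.lt t t', .lt _ _, fun γ => by rw [Formula.Realize, ht, ht']; rfl⟩

instance BoundedDefinable.mem (f : Γ → M.Num) [hf : TermDefinable f] (A : M.Sets) :
    BoundedDefinable (M := M) fun γ => f γ ∈ (A : Set M.Num) := by
  obtain ⟨s, hs⟩ := hf.out
  refine ⟨s, {A}, fun m k p V hp hV => ?_⟩
  obtain ⟨t, ht⟩ := hs m p hp
  obtain ⟨i, rfl⟩ := hV A (by simp)
  exact ⟨.mem t i, .mem _ _, fun γ => by rw [Formula.Realize, ht]⟩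

instance BoundedDefinable.not (R : Γ → Prop) [hR : BoundedDefinable (M := M) R] :
    BoundedDefinable (M := M) fun γ => ¬ R γ := by
  obtain ⟨s, S, h⟩ := hR.out
  refine ⟨s, S, fun m k p V hp hV => ?_⟩
  obtain ⟨φ, hφ, h⟩ := h m k p V hp hV
  exact ⟨.not φ, .not hφ, fun γ => not_congr (h γ)⟩

instance BoundedDefinable.and (R R' : Γ → Prop) [hR : BoundedDefinable (M := M) R]
    [hR' : BoundedDefinable (M := M) R'] : BoundedDefinable (M := M) fun γ => R γ ∧ R' γ := by
  classical
  obtain ⟨s, S, h⟩ := hR.out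
  obtain ⟨s', S', h'⟩ := hR'.out
  refine ⟨s ∪ s', S ∪ S', fun m k p V hp hV => ?_⟩
  obtain ⟨φ, hφ, h⟩ := h m k p V (fun a ha => hp a (Finset.mem_union_left _ ha))
    fun A hA => hV A (Finset.mem_union_left _ hA)
  obtain ⟨φ', hφ', h'⟩ := h' m k p V (fun a ha => hp a (Finset.mem_union_right _ ha))
    fun A hA => hV A (Finset.mem_union_right _ hA)
  exact ⟨.and φ φ', .and hφ hφ', fun γ => and_congr (h γ) (h' γ)⟩

/-- By classical logic `∨`, `→` and bounded `∃` reduce to `¬`, `∧` and bounded `∀`. -/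
instance BoundedDefinable.or (R R' : Γ → Prop) [BoundedDefinable (M := M) R]
    [BoundedDefinable (M := M) R'] : BoundedDefinable (M := M) fun γ => R γ ∨ R' γ := by
  have : BoundedDefinable (M := M) fun γ => ¬ (¬ R γ ∧ ¬ R' γ) := inferInstance
  simpa only [not_and_or, not_not] using this

instance BoundedDefinable.imp (R R' : Γ → Prop) [BoundedDefinable (M := M) R]
    [BoundedDefinable (M := M) R'] : BoundedDefinable (M := M) fun γ => R γ → R' γ := by
  have : BoundedDefinable (M := M) fun γ => ¬ (R γ ∧ ¬ R' γ) := inferInstance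
  simpa only [not_and, not_not] using this

instance BoundedDefinable.forall_lt (f : Γ → M.Num) [hf : TermDefinable f]
    (R : Γ → M.Num → Prop) [hR : BoundedDefinable (M := M) fun γ : Γ × M.Num => R γ.1 γ.2] :
    BoundedDefinable (M := M) fun γ => ∀ a, a < f γ → R γ a := by
  classical
  obtain ⟨s, hs⟩ := hf.out
  obtain ⟨s', S, h⟩ := hR.out
  refine ⟨s ∪ s', S, fun m k p V hp hV => ?_⟩
  obtain ⟨t, ht⟩ := hs m p fun a ha => hp a (Finset.mem_union_left _ ha)
  obtain ⟨φ, hφ, h⟩ := h m k p V (fun a ha => hp a (Finset.mem_union_right _ ha)) hV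
  refine ⟨_, .ball t hφ, fun γ => forall_congr' fun a => ?_⟩
  refine imp_congr ?_ (h (γ, a))
  simp only [Formula.Realize, Term.eval_lift, ht]
  simp only [Term.eval, Fin.snoc_last]
  rfl

instance BoundedDefinable.exists_lt (f : Γ → M.Num) [TermDefinable f]
    (R : Γ → M.Num → Prop) [BoundedDefinable (M := M) fun γ : Γ × M.Num => R γ.1 γ.2] :
    BoundedDefinable (M := M) fun γ => ∃ a, a < f γ ∧ R γ a := by
  have : BoundedDefinable (M := M) fun γ => ¬ ∀ a, a < f γ → ¬ R γ a := inferInstance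
  simpa only [not_forall, not_not, exists_prop] using this

variable (M) in
/-- The context with a single variable. -/
abbrev Unary : Type u := PUnit.{u + 1} × M.Num

/-! ### Induction and comprehension for definable predicates -/

theorem sigma1_induction (hM : ∀ ψ ∈ RCA₀, M.Satisfies ψ) (R : M.Num → M.Num → Prop)
    [hR : BoundedDefinable (M := M) fun γ : Unary M × M.Num => R γ.1.2 γ.2]
    (zero : ∃ w, R 0 w) (succ : ∀ a, (∃ w, R a w) → ∃ w, R (a + 1) w) (a : M.Num) :
    ∃ w, R a w := by
  obtain ⟨s, S, h⟩ := hR.out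
  -- The finitely many parameters become free variables of the formula, valued by an enumeration of
  -- `s` and `S`; the universally closed axiom is then instantiated at this enumeration.
  obtain ⟨φ, hφ, h⟩ := h s.card S.card (fun i => s.equivFin.symm i) (fun i => S.equivFin.symm i)
    (fun a ha => ⟨s.equivFin ⟨a, ha⟩, by simp⟩) fun A hA => ⟨S.equivFin ⟨A, hA⟩, by simp⟩
  have key := (satisfies_close _).1 (hM _ (Or.inr (Or.inl ⟨_, _, .ex φ, ⟨φ, hφ, rfl⟩, rfl⟩)))
    (fun i => s.equivFin.symm i) fun i => S.equivFin.symm i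
  have e : ∀ a, Formula.Realize M (.ex φ) (Fin.snoc (n := s.card) (α := fun _ => M.Num)
      (fun i => s.equivFin.symm i) a) (fun i => S.equivFin.symm i) ↔ ∃ w, R a w :=
    fun a => exists_congr fun w => h ((⟨⟩, a), w)
  refine (e a).1 (key ⟨?_, fun a ha => ?_⟩ a)
  · exact (Formula.realize_atZero _ _ _).2 ((e _).2 zero)
  · exact (Formula.realize_atSucc _ _ _ _).2 ((e _).2 (succ a ((e a).1 ha)))

theorem delta1_comprehension (hM : ∀ ψ ∈ RCA₀, M.Satisfies ψ) (R R' : M.Num → M.Num → Prop)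
    [hR : BoundedDefinable (M := M) fun γ : Unary M × M.Num => R γ.1.2 γ.2]
    [hR' : BoundedDefinable (M := M) fun γ : Unary M × M.Num => R' γ.1.2 γ.2]
    (hRR' : ∀ a, (∃ w, R a w) ↔ ∀ w, R' a w) :
    ∃ A : M.Sets, ∀ a, a ∈ (A : Set M.Num) ↔ ∃ w, R a w := by
  classical
  obtain ⟨s₁, S₁, h⟩ := hR.out
  obtain ⟨s₂, S₂, h'⟩ := hR'.out
  -- Both formulas must have the same free variables, so the parameters are merged before either
  -- formula is chosen.
  obtain ⟨s, hs⟩ : ∃ s, s = s₁ ∪ s₂ := ⟨_, rfl⟩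
  obtain ⟨S, hS⟩ : ∃ S, S = S₁ ∪ S₂ := ⟨_, rfl⟩
  obtain ⟨φ, hφ, h⟩ := h s.card S.card (fun i => s.equivFin.symm i) (fun i => S.equivFin.symm i)
    (fun a ha => ⟨s.equivFin ⟨a, hs ▸ Finset.mem_union_left _ ha⟩, by simp⟩)
    fun A hA => ⟨S.equivFin ⟨A, hS ▸ Finset.mem_union_left _ hA⟩, by simp⟩
  obtain ⟨ψ, hψ, h'⟩ := h' s.card S.card (fun i => s.equivFin.symm i)
    (fun i => S.equivFin.symm i)
    (fun a ha => ⟨s.equivFin ⟨a, hs ▸ Finset.mem_union_right _ ha⟩, by simp⟩)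
    fun A hA => ⟨S.equivFin ⟨A, hS ▸ Finset.mem_union_right _ hA⟩, by simp⟩
  have key := (satisfies_close _).1 (hM _ (Or.inr (Or.inr ⟨_, _, .ex φ, .all ψ, ⟨φ, hφ, rfl⟩,
    ⟨ψ, hψ, rfl⟩, rfl⟩))) (fun i => s.equivFin.symm i) fun i => S.equivFin.symm i
  have e : ∀ a, Formula.Realize M (.ex φ) (Fin.snoc (n := s.card) (α := fun _ => M.Num)
      (fun i => s.equivFin.symm i) a) (fun i => S.equivFin.symm i) ↔ ∃ w, R a w :=
    fun a => exists_congr fun w => h ((⟨⟩, a), w)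
  have e' : ∀ a, Formula.Realize M (.all ψ) (Fin.snoc (n := s.card) (α := fun _ => M.Num)
      (fun i => s.equivFin.symm i) a) (fun i => S.equivFin.symm i) ↔ ∀ w, R' a w :=
    fun a => forall_congr' fun w => h' ((⟨⟩, a), w)
  obtain ⟨A, hA⟩ := key fun a =>
    ⟨fun h => (e' a).2 ((hRR' a).1 ((e a).1 h)), fun h => (e a).2 ((hRR' a).2 ((e' a).1 h))⟩
  refine ⟨A, fun a => ?_⟩
  have := hA a
  simp only [Formula.iff, Formula.Realize, Formula.realize_liftSet, Term.eval, Fin.snoc_last,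
    ← iff_iff_implies_and_implies] at this
  exact this.trans (e a)

theorem bounded_induction (hM : ∀ ψ ∈ RCA₀, M.Satisfies ψ) (R : M.Num → Prop)
    [BoundedDefinable (M := M) fun γ : Unary M × M.Num => R γ.1.2]
    (zero : R 0) (succ : ∀ a, R a → R (a + 1)) (a : M.Num) : R a :=
  let ⟨_, h⟩ := sigma1_induction hM (fun a _ => R a) ⟨0, zero⟩ (fun a ⟨w, h⟩ => ⟨w, succ a h⟩) a
  h

end Definability

/-! ## Arithmetic in models of `RCA₀` -/

/-- `M` is a model of `RCA₀`. -/
class ModelsRCA₀ (M : L2Structure.{u}) : Prop where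
  satisfies : ∀ ψ ∈ RCA₀, M.Satisfies ψ

namespace ModelsRCA₀

variable {M : L2Structure.{u}}

theorem eval_var {n : ℕ} (i : Fin n) (v : Fin n → M.Num) : (𝓍 i).eval M v = v i := rfl

theorem eval_zero {n : ℕ} (v : Fin n → M.Num) : (0 : Term n).eval M v = 0 := rfl

theorem eval_one {n : ℕ} (v : Fin n → M.Num) : (1 : Term n).eval M v = 1 := rfl

theorem eval_add {n : ℕ} (s t : Term n) (v : Fin n → M.Num) :
    (s + t).eval M v = s.eval M v + t.eval M v := rfl

theorem eval_mul {n : ℕ} (s t : Term n) (v : Fin n → M.Num) :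
    (s * t).eval M v = s.eval M v * t.eval M v := rfl

theorem realize_eq {n k : ℕ} (s t : Term n) (v : Fin n → M.Num) (V : Fin k → M.Sets) :
    (s ≐ t).Realize M v V ↔ s.eval M v = t.eval M v := Iff.rfl

theorem realize_lt {n k : ℕ} (s t : Term n) (v : Fin n → M.Num) (V : Fin k → M.Sets) :
    (s ≺ₙ t).Realize M v V ↔ s.eval M v < t.eval M v := Iff.rfl

variable [hM : ModelsRCA₀ M]

theorem realize_basic {φ : Formula 2 0} (h : φ ∈ basicAxioms) (a b : M.Num) :
    φ.Realize M ![a, b] Fin.elim0 :=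
  (satisfies_close φ).1 (hM.satisfies _ (Or.inl ⟨φ, h, rfl⟩)) _ _

theorem realize_basicAxioms (a b : M.Num) :
    a + 1 ≠ 0 ∧ (a + 1 = b + 1 → a = b) ∧ a + 0 = a ∧ a + (b + 1) = a + b + 1 ∧ a * 0 = 0 ∧
      a * (b + 1) = a * b + a ∧ ¬ a < 0 ∧ (a < b + 1 ↔ a < b ∨ a = b) := by
  have h : ∀ φ ∈ basicAxioms, φ.Realize M ![a, b] Fin.elim0 := fun φ h => realize_basic h a b
  simpa only [basicAxioms, Set.mem_insert_iff, Set.mem_singleton_iff, forall_eq_or_imp, forall_eq,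
    Formula.iff, Formula.Realize.eq_4, Formula.Realize.eq_5, Formula.Realize.eq_6,
    Formula.Realize.eq_7, realize_eq, realize_lt, eval_var, eval_zero, eval_one, eval_add,
    eval_mul, Matrix.cons_val_zero, Matrix.cons_val_one, ← iff_iff_implies_and_implies] using h

theorem succ_ne_zero (a : M.Num) : a + 1 ≠ 0 := (realize_basicAxioms a a).1

theorem succ_inj {a b : M.Num} : a + 1 = b + 1 → a = b := (realize_basicAxioms a b).2.1

theorem add_zero' (a : M.Num) : a + 0 = a := (realize_basicAxioms a a).2.2.1

theorem add_succ (a b : M.Num) : a + (b + 1) = a + b + 1 := (realize_basicAxioms a b).2.2.2.1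

theorem mul_zero' (a : M.Num) : a * 0 = 0 := (realize_basicAxioms a a).2.2.2.2.1

theorem mul_succ (a b : M.Num) : a * (b + 1) = a * b + a :=
  (realize_basicAxioms a b).2.2.2.2.2.1

theorem not_lt_zero' (a : M.Num) : ¬ a < 0 := (realize_basicAxioms a a).2.2.2.2.2.2.1

theorem lt_succ {a b : M.Num} : a < b + 1 ↔ a < b ∨ a = b :=
  (realize_basicAxioms a b).2.2.2.2.2.2.2

theorem induction (R : M.Num → Prop)
    [BoundedDefinable (M := M) fun γ : Unary M × M.Num => R γ.1.2]
    (zero : R 0) (succ : ∀ a, R a → R (a + 1)) (a : M.Num) : R a :=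
  bounded_induction hM.satisfies R zero succ a

theorem zero_add' (a : M.Num) : 0 + a = a :=
  induction (fun a => 0 + a = a) (add_zero' 0) (fun a h => by rw [add_succ, h]) a

theorem succ_add (a b : M.Num) : a + 1 + b = a + b + 1 :=
  induction (fun b => a + 1 + b = a + b + 1) (by rw [add_zero', add_zero'])
    (fun b h => by rw [add_succ, h, add_succ]) b

theorem add_comm' (a b : M.Num) : a + b = b + a :=
  induction (fun b => a + b = b + a) (by rw [add_zero', zero_add'])
    (fun b h => by rw [add_succ, h, succ_add]) b

theorem add_assoc' (a b c : M.Num) : a + b + c = a + (b + c) :=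
  induction (fun c => a + b + c = a + (b + c)) (by rw [add_zero', add_zero'])
    (fun c h => by rw [add_succ, h, add_succ, add_succ]) c

theorem zero_mul' (a : M.Num) : 0 * a = 0 :=
  induction (fun a => 0 * a = 0) (mul_zero' 0) (fun a h => by rw [mul_succ, h, add_zero']) a

theorem succ_mul (a b : M.Num) : (a + 1) * b = a * b + b :=
  induction (fun b => (a + 1) * b = a * b + b) (by rw [mul_zero', mul_zero', add_zero'])
    (fun b h => by
      rw [mul_succ, h, mul_succ, add_succ, add_succ, add_assoc' (a * b) b a, add_comm' b a,
        ← add_assoc']) b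

theorem mul_comm' (a b : M.Num) : a * b = b * a :=
  induction (fun b => a * b = b * a) (by rw [mul_zero', zero_mul'])
    (fun b h => by rw [mul_succ, h, succ_mul]) b

theorem mul_add' (a b c : M.Num) : a * (b + c) = a * b + a * c :=
  induction (fun c => a * (b + c) = a * b + a * c) (by rw [add_zero', mul_zero', add_zero'])
    (fun c h => by rw [add_succ, mul_succ, h, mul_succ, add_assoc']) c

theorem mul_assoc' (a b c : M.Num) : a * b * c = a * (b * c) :=
  induction (fun c => a * b * c = a * (b * c)) (by rw [mul_zero', mul_zero', mul_zero'])
    (fun c h => by rw [mul_succ, h, mul_succ, mul_add']) c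

theorem mul_one' (a : M.Num) : a * 1 = a := by
  rw [← zero_add' (1 : M.Num), mul_succ, mul_zero', zero_add']

instance : CommSemiring M.Num where
  add_assoc := add_assoc'
  zero_add := zero_add'
  add_zero := add_zero'
  add_comm := add_comm'
  left_distrib := mul_add'
  right_distrib a b c := by rw [mul_comm', mul_add', mul_comm' c a, mul_comm' c b]
  zero_mul := zero_mul'
  mul_zero := mul_zero'
  mul_assoc := mul_assoc'
  one_mul a := by rw [mul_comm', mul_one']
  mul_one := mul_one'
  mul_comm := mul_comm'
  nsmul := nsmulRec

theorem add_right_cancel' {a b : M.Num} (c : M.Num) : a + c = b + c → a = b :=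
  induction (fun c => a + c = b + c → a = b) (by simp)
    (fun c h h' => h (succ_inj (by simpa only [add_succ] using h'))) c

/-! ### The order of the number part -/

theorem exists_of_lt {a b : M.Num} : a < b → ∃ c, b = a + (c + 1) := by
  -- The witness `c` is an unbounded quantifier, so this is `Σ⁰₁` induction on `b`. If `a < b`
  -- fails, `a < b + 1` forces `a = b` and `c = 0` works.
  have key := sigma1_induction hM.satisfies (fun b c => a < b → b = a + (c + 1))
    ⟨0, fun h => (not_lt_zero' _ h).elim⟩ (fun b ⟨c, hc⟩ => ?_) b
  · exact fun h => key.imp fun c hc => hc h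
  · by_cases h : a < b
    · exact ⟨c + 1, fun _ => by rw [add_succ, ← hc h]⟩
    · refine ⟨0, fun h' => ?_⟩
      rw [(lt_succ.1 h').resolve_left h, zero_add]

theorem lt_add_succ (a c : M.Num) : a < a + (c + 1) :=
  induction (fun c => a < a + (c + 1)) (by rw [zero_add]; exact lt_succ.2 (Or.inr rfl))
    (fun c h => by rw [add_succ]; exact lt_succ.2 (Or.inl h)) c

theorem lt_irrefl' (a : M.Num) : ¬ a < a := by
  intro h
  obtain ⟨c, hc⟩ := exists_of_lt h
  refine succ_ne_zero c (add_right_cancel' a ?_)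
  rw [add_comm, ← hc, zero_add]

theorem lt_trans' {a b c : M.Num} (h : a < b) (h' : b < c) : a < c := by
  obtain ⟨d, rfl⟩ := exists_of_lt h
  obtain ⟨e, rfl⟩ := exists_of_lt h'
  rw [add_assoc, ← add_assoc (d + 1)]
  exact lt_add_succ _ _

theorem zero_or_succ (a : M.Num) : a = 0 ∨ 0 < a :=
  induction (fun a => a = 0 ∨ 0 < a) (Or.inl rfl)
    (fun _ h => Or.inr (lt_succ.2 (h.symm.imp_right Eq.symm))) a

theorem add_lt_add_right' {a b : M.Num} (h : a < b) (c : M.Num) : a + c < b + c := by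
  obtain ⟨d, rfl⟩ := exists_of_lt h
  rw [add_right_comm]
  exact lt_add_succ _ _

theorem trichotomy (a b : M.Num) : a < b ∨ a = b ∨ b < a :=
  induction (fun b => a < b ∨ a = b ∨ b < a) (Or.inr ((zero_or_succ a).imp_right id)) (by
    rintro b (h | rfl | h)
    · exact Or.inl (lt_succ.2 (Or.inl h))
    · exact Or.inl (lt_succ.2 (Or.inr rfl))
    · obtain ⟨c, rfl⟩ := exists_of_lt h
      rcases zero_or_succ c with rfl | hc
      · exact Or.inr (Or.inl (by simp))
      · obtain ⟨d, rfl⟩ := exists_of_lt hc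
        refine Or.inr (Or.inr ?_)
        rw [zero_add, add_succ, add_right_comm]
        exact lt_add_succ _ _) b

open Classical in
noncomputable instance : LinearOrder M.Num where
  le a b := a < b ∨ a = b
  le_refl _ := Or.inr rfl
  le_trans a b c := by
    rintro (h | rfl) (h' | rfl)
    exacts [Or.inl (lt_trans' h h'), Or.inl h, Or.inl h', Or.inr rfl]
  le_antisymm a b := by
    rintro (h | rfl) (h' | h')
    exacts [(lt_irrefl' _ (lt_trans' h h')).elim, h'.symm, rfl, rfl]
  lt_iff_le_not_ge a b := by
    refine ⟨fun h => ⟨Or.inl h, ?_⟩, ?_⟩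
    · rintro (h' | rfl)
      exacts [lt_irrefl' _ (lt_trans' h h'), lt_irrefl' _ h]
    · rintro ⟨h | rfl, h'⟩
      exacts [h, (h' (Or.inr rfl)).elim]
  le_total a b := by
    rcases trichotomy a b with h | h | h
    exacts [Or.inl (Or.inl h), Or.inl (Or.inr h), Or.inr (Or.inl h)]
  toDecidableLE := Classical.decRel _

instance : CanonicallyOrderedAdd M.Num where
  exists_add_of_le {a b} h := by
    rcases h.lt_or_eq with h | rfl
    · exact (exists_of_lt h).imp' _ fun c hc => hc
    · exact ⟨0, by simp⟩
  le_add_self _ b := by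
    rcases zero_or_succ b with rfl | h
    · simp
    · obtain ⟨c, rfl⟩ := exists_of_lt h
      rw [zero_add, add_comm]
      exact (lt_add_succ _ _).le
  le_self_add _ b := by
    rcases zero_or_succ b with rfl | h
    · simp
    · obtain ⟨c, rfl⟩ := exists_of_lt h
      rw [zero_add]
      exact (lt_add_succ _ _).le

theorem lt_add_one_iff {a b : M.Num} : a < b + 1 ↔ a ≤ b := lt_succ

theorem add_one_le {a b : M.Num} (h : a < b) : a + 1 ≤ b := by
  obtain ⟨c, rfl⟩ := exists_of_lt h
  rw [add_comm c, ← add_assoc]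
  exact le_self_add

theorem mul_lt_mul_left' {a b c : M.Num} (h : a < b) (hc : 0 < c) : c * a < c * b := by
  obtain ⟨d, rfl⟩ := exists_of_lt h
  obtain ⟨e, rfl⟩ := exists_of_lt hc
  have : (0 + (e + 1)) * (a + (d + 1)) = (0 + (e + 1)) * a + ((e * d + e + d) + 1) := by ring
  rw [this]
  exact lt_add_succ _ _

instance : IsStrictOrderedRing M.Num where
  add_le_add_left a b h c := by
    rcases h.lt_or_eq with h | rfl
    · exact (add_lt_add_right' h c).le
    · exact le_rfl
  le_of_add_le_add_left a b c h := by
    by_contra! h'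
    have := add_lt_add_right' h' a
    rw [add_comm c, add_comm b] at this
    exact absurd h this.not_ge
  zero_le_one := zero_le
  exists_pair_ne := ⟨0, 1, fun h => succ_ne_zero (0 : M.Num) (by rw [zero_add, ← h])⟩
  mul_lt_mul_of_pos_left c hc a b h := mul_lt_mul_left' h hc
  mul_lt_mul_of_pos_right c hc a b h := by
    simpa only [mul_comm] using mul_lt_mul_left' h hc

instance _root_.SecondOrderArithmetic.BoundedDefinable.le {Γ : Type u} [Context M Γ]
    (f g : Γ → M.Num) [TermDefinable f] [TermDefinable g] :
    BoundedDefinable (M := M) fun γ => f γ ≤ g γ := by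
  have : BoundedDefinable (M := M) fun γ => f γ < g γ + 1 := inferInstance
  simpa only [lt_add_one_iff] using this

/-! ## Stern–Brocot intervals -/

theorem fraction_le_trans {a b c d e f : M.Num} (hd : 0 < d) (h : a * d ≤ c * b)
    (h' : c * f ≤ e * d) : a * f ≤ e * b := by
  refine le_of_mul_le_mul_left ?_ hd
  calc d * (a * f) = a * d * f := by ring
    _ ≤ c * b * f := mul_le_mul_left h f
    _ = c * f * b := by ring
    _ ≤ e * d * b := mul_le_mul_left h' b
    _ = d * (e * b) := by ring

theorem fraction_lt_of_lt_of_le {a b c d e f : M.Num} (hf : 0 < f)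
    (h : a * d < c * b) (h' : c * f ≤ e * d) : a * f < e * b := by
  by_contra! hn
  exact h.not_ge (fraction_le_trans hf h' hn)

theorem fraction_lt_of_le_of_lt {a b c d e f : M.Num} (hb : 0 < b)
    (h : a * d ≤ c * b) (h' : c * f < e * d) : a * f < e * b := by
  by_contra! hn
  exact h'.not_ge (fraction_le_trans hb hn h)

/-- With `p b - a q = k + 1` and `c q - p d = l + 1`, the determinant being `1` gives `p = (l + 1) a
+ (k + 1) c` and `q = (l + 1) b + (k + 1) d`. So the mediant has the least numerator and denominator
strictly inside the interval. -/
theorem mediant_le {a b c d p q : M.Num} (h : b * c = a * d + 1) (h₁ : a * q < p * b)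
    (h₂ : p * d < c * q) : a + c ≤ p ∧ b + d ≤ q := by
  obtain ⟨k, hk⟩ := exists_of_lt h₁
  obtain ⟨l, hl⟩ := exists_of_lt h₂
  have hp : p = a + c + (a * l + c * k) := by grind
  have hq : q = b + d + (b * l + d * k) := by grind
  exact ⟨hp ▸ le_self_add, hq ▸ le_self_add⟩

/-- Multiplying the determinant equation by `d'` gives `d' = d (b c' - a d')`, so `d` divides `d'`:
the end points are in lowest terms. -/
theorem right_denominator_le {a b c d c' d' : M.Num} (h : b * c = a * d + 1) (hd' : 0 < d')
    (h' : c * d' = c' * d) : d ≤ d' := by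
  have key : d * (b * c') = d * (a * d') + d' := by grind
  have : a * d' < b * c' := by
    by_contra! hn
    have h₁ := mul_le_mul_right hn d
    rw [key] at h₁
    exact (lt_add_of_pos_right _ hd').not_ge h₁
  obtain ⟨k, hk⟩ := exists_of_lt this
  have : d' = d + d * k := by grind
  exact this ▸ le_self_add

theorem left_denominator_le {a b c d a' b' : M.Num} (h : b * c = a * d + 1) (hb' : 0 < b')
    (h' : a * b' = a' * b) : b ≤ b' := by
  have key : b * (b' * c) = b * (a' * d) + b' := by grind
  have : a' * d < b' * c := by
    by_contra! hn
    have h₁ := mul_le_mul_right hn b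
    rw [key] at h₁
    exact (lt_add_of_pos_right _ hb').not_ge h₁
  obtain ⟨k, hk⟩ := exists_of_lt this
  have : b' = b + b * k := by grind
  exact this ▸ le_self_add

variable (M) in
/-- The interval between the fractions `a / b` and `c / d`. -/
@[ext]
structure Interval where
  a : M.Num
  b : M.Num
  c : M.Num
  d : M.Num

namespace Interval

/-- The sum of the numerators and denominators of the end points. -/
def size (J : Interval M) : M.Num := J.a + J.b + J.c + J.d

/-- The intervals of the Stern–Brocot tree. -/
structure Unimodular (J : Interval M) : Prop where
  det : J.b * J.c = J.a * J.d + 1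
  b_pos : 0 < J.b
  d_pos : 0 < J.d

/-- Inclusion of intervals. -/
structure Within (J K : Interval M) : Prop where
  left : K.a * J.b ≤ J.a * K.b
  right : J.c * K.d ≤ K.c * J.d

/-- The interval between the left end point and the mediant. -/
def lower (J : Interval M) : Interval M := ⟨J.a, J.b, J.a + J.c, J.b + J.d⟩

/-- The interval between the mediant and the right end point. -/
def upper (J : Interval M) : Interval M := ⟨J.a + J.c, J.b + J.d, J.c, J.d⟩

set_option linter.unusedSectionVars false in
theorem unimodular_iff {J : Interval M} :
    J.Unimodular ↔ J.b * J.c = J.a * J.d + 1 ∧ 0 < J.b ∧ 0 < J.d :=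
  ⟨fun h => ⟨h.1, h.2, h.3⟩, fun h => ⟨h.1, h.2.1, h.2.2⟩⟩

theorem within_iff {J K : Interval M} :
    J.Within K ↔ K.a * J.b ≤ J.a * K.b ∧ J.c * K.d ≤ K.c * J.d :=
  ⟨fun h => ⟨h.1, h.2⟩, fun h => ⟨h.1, h.2⟩⟩

theorem Within.refl (J : Interval M) : J.Within J := ⟨le_rfl, le_rfl⟩

theorem Within.trans {J K L : Interval M} (hK : K.Unimodular) (h : J.Within K)
    (h' : K.Within L) : J.Within L :=
  ⟨fraction_le_trans hK.b_pos h'.left h.left, fraction_le_trans hK.d_pos h.right h'.right⟩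

theorem Unimodular.lt {J : Interval M} (h : J.Unimodular) : J.a * J.d < J.c * J.b := by
  rw [mul_comm J.c, h.det]
  exact lt_add_one_iff.2 le_rfl

theorem Unimodular.left_lt_mediant {J : Interval M} (h : J.Unimodular) :
    J.a * (J.b + J.d) < (J.a + J.c) * J.b := by
  rw [mul_add, add_mul]
  exact add_lt_add_right h.lt _

theorem Unimodular.mediant_lt_right {J : Interval M} (h : J.Unimodular) :
    (J.a + J.c) * J.d < J.c * (J.b + J.d) := by
  rw [mul_add, add_mul]
  exact add_lt_add_left h.lt _

theorem Unimodular.lower {J : Interval M} (h : J.Unimodular) : J.lower.Unimodular :=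
  ⟨by have := h.det; simp only [Interval.lower]; grind, h.b_pos,
    add_pos_of_pos_of_nonneg h.b_pos zero_le⟩

theorem Unimodular.upper {J : Interval M} (h : J.Unimodular) : J.upper.Unimodular :=
  ⟨by have := h.det; simp only [Interval.upper]; grind,
    add_pos_of_pos_of_nonneg h.b_pos zero_le, h.d_pos⟩

theorem Unimodular.lower_within {J : Interval M} (h : J.Unimodular) : J.lower.Within J :=
  ⟨le_rfl, h.mediant_lt_right.le⟩

theorem Unimodular.upper_within {J : Interval M} (h : J.Unimodular) : J.upper.Within J :=
  ⟨h.left_lt_mediant.le, le_rfl⟩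

theorem Unimodular.size_lt_lower {J : Interval M} (h : J.Unimodular) : J.size < J.lower.size := by
  have : J.lower.size = J.size + (J.a + J.b) := by simp only [Interval.lower, size]; ring
  rw [this]
  exact lt_add_of_pos_right _ (add_pos_of_nonneg_of_pos zero_le h.b_pos)

theorem Unimodular.size_lt_upper {J : Interval M} (h : J.Unimodular) : J.size < J.upper.size := by
  have : J.upper.size = J.size + (J.c + J.d) := by simp only [Interval.upper, size]; ring
  rw [this]
  exact lt_add_of_pos_right _ (add_pos_of_nonneg_of_pos zero_le h.d_pos)

/-- The mediant of `J` lies strictly inside `K`, so `mediant_le` applies to it. -/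
theorem Within.sums_le {J K : Interval M} (hJ : J.Unimodular) (hK : K.Unimodular)
    (h : J.Within K) : K.a + K.c ≤ J.a + J.c ∧ K.b + K.d ≤ J.b + J.d := by
  have hpos : 0 < J.b + J.d := add_pos_of_pos_of_nonneg hJ.b_pos zero_le
  exact mediant_le hK.det
    (fraction_lt_of_le_of_lt hK.b_pos h.left hJ.left_lt_mediant)
    (fraction_lt_of_lt_of_le hK.d_pos hJ.mediant_lt_right h.right)

theorem Within.size_le {J K : Interval M} (hJ : J.Unimodular) (hK : K.Unimodular)
    (h : J.Within K) : K.size ≤ J.size := by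
  have := add_le_add (h.sums_le hJ hK).1 (h.sums_le hJ hK).2
  simp only [size]
  calc K.a + K.b + K.c + K.d = K.a + K.c + (K.b + K.d) := by ring
    _ ≤ J.a + J.c + (J.b + J.d) := this
    _ = J.a + J.b + J.c + J.d := by ring

/-- The tree property: an interval of the tree containing a child is the child itself or contains
the parent. Otherwise the left end point of `K` would lie strictly inside `J`, which makes its
entries at least those of the mediant of `J`, while `sums_le` bounds the entries of `K` from above;
together these force `K = J.upper`. -/
theorem within_of_upper_within {J K : Interval M} (hJ : J.Unimodular) (hK : K.Unimodular)
    (h : J.upper.Within K) (hne : K ≠ J.upper) : J.Within K := by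
  refine ⟨?_, h.right⟩
  by_contra! hlt
  have hsum := h.sums_le hJ.upper hK
  have hl := h.left
  have hr := h.right
  simp only [Interval.upper] at hsum hl hr
  have hpos : 0 < J.b + J.d := add_pos_of_pos_of_nonneg hJ.b_pos zero_le
  obtain ⟨h₁, h₂⟩ := mediant_le hJ.det hlt
    (fraction_lt_of_le_of_lt hK.b_pos hl hJ.mediant_lt_right)
  have hd : K.d ≤ J.d := by grind
  have hKJ : K.a * J.d < J.c * K.b :=
    fraction_lt_of_le_of_lt hK.b_pos hl hJ.mediant_lt_right
  -- If the right end points differed, that of `J` would lie strictly inside `K`, giving `K.b + K.d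
  -- ≤ J.d`; but `J.b + J.d ≤ K.b`.
  have hcd : J.c * K.d = K.c * J.d := by
    by_contra hcd
    have h₃ := (mediant_le hK.det hKJ (lt_of_le_of_ne hr hcd)).2
    have hKb := hK.b_pos
    have hJb := hJ.b_pos
    have hKd := hK.d_pos
    grind
  have hd' : J.d = K.d := le_antisymm (right_denominator_le hJ.det hK.d_pos hcd) hd
  have hc : J.c = K.c := by
    rw [hd'] at hcd
    exact mul_right_cancel₀ hK.d_pos.ne' hcd
  refine hne (Interval.ext ?_ ?_ hc.symm hd'.symm) <;> simp only [Interval.upper] <;> grind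

theorem within_of_lower_within {J K : Interval M} (hJ : J.Unimodular) (hK : K.Unimodular)
    (h : J.lower.Within K) (hne : K ≠ J.lower) : J.Within K := by
  refine ⟨h.left, ?_⟩
  by_contra! hlt
  have hsum := h.sums_le hJ.lower hK
  have hl := h.left
  have hr := h.right
  simp only [Interval.lower] at hsum hl hr
  have hpos : 0 < J.b + J.d := add_pos_of_pos_of_nonneg hJ.b_pos zero_le
  have hJK : J.a * K.d < K.c * J.b :=
    fraction_lt_of_lt_of_le hK.d_pos hJ.left_lt_mediant hr
  obtain ⟨h₁, h₂⟩ := mediant_le hJ.det hJK hlt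
  have hb : K.b ≤ J.b := by grind
  have hab : J.a * K.b = K.a * J.b := by
    by_contra hab
    have h₃ := (mediant_le hK.det (lt_of_le_of_ne hl (Ne.symm hab)) hJK).2
    have hKb := hK.b_pos
    have hJd := hJ.d_pos
    have hKd := hK.d_pos
    grind
  have hb' : J.b = K.b := le_antisymm (left_denominator_le hJ.det hK.b_pos hab) hb
  have ha : J.a = K.a := by
    rw [hb'] at hab
    exact mul_right_cancel₀ hK.b_pos.ne' hab
  refine hne (Interval.ext ha.symm hb'.symm ?_ ?_) <;> simp only [Interval.lower] <;> grind

end Interval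

namespace Interval

/-! ## Definability of relations between intervals -/

section Definability

variable {Γ : Type u} [Context M Γ] (a b c d a' b' c' d' e : Γ → M.Num)
  [TermDefinable a] [TermDefinable b] [TermDefinable c] [TermDefinable d]
  [TermDefinable a'] [TermDefinable b'] [TermDefinable c'] [TermDefinable d'] [TermDefinable e]

instance : TermDefinable fun γ => size (⟨a γ, b γ, c γ, d γ⟩ : Interval M) := by
  dsimp only [size]
  infer_instance

instance : BoundedDefinable (M := M) fun γ =>
    Unimodular (⟨a γ, b γ, c γ, d γ⟩ : Interval M) := by
  simp only [unimodular_iff]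
  infer_instance

instance : BoundedDefinable (M := M) fun γ =>
    Within (⟨a γ, b γ, c γ, d γ⟩ : Interval M) ⟨a' γ, b' γ, c' γ, d' γ⟩ := by
  simp only [within_iff]
  infer_instance

instance : BoundedDefinable (M := M) fun γ =>
    (⟨a γ, b γ, c γ, d γ⟩ : Interval M) = ⟨a' γ, b' γ, c' γ, d' γ⟩ := by
  simp only [Interval.mk.injEq]
  infer_instance

end Definability

/-- Turns a quantifier over intervals of bounded size into four bounded number quantifiers. -/
theorem entries_lt {J : Interval M} {s : M.Num} (h : J.size < s) :
    J.a < s ∧ J.b < s ∧ J.c < s ∧ J.d < s := by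
  have h₁ : J.a + J.b + J.c ≤ J.size := le_self_add
  have h₂ : J.a + J.b ≤ J.size := le_self_add.trans h₁
  exact ⟨(le_self_add.trans h₂).trans_lt h, (le_add_self.trans h₂).trans_lt h,
    (le_add_self.trans h₁).trans_lt h, le_add_self.trans_lt h⟩

/-- A quadruple of witnesses is replaced by one common strict bound `s`, to get a single unbounded
quantifier. -/
theorem induction (R : M.Num → Interval M → Prop)
    [BoundedDefinable (M := M) fun γ : ((((Unary M × M.Num) × M.Num) × M.Num) × M.Num) × M.Num =>
      R γ.1.1.1.1.1.2 ⟨γ.1.1.1.2, γ.1.1.2, γ.1.2, γ.2⟩]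
    (zero : ∃ J, R 0 J) (succ : ∀ x J, R x J → ∃ J, R (x + 1) J) (x : M.Num) : ∃ J, R x J := by
  have key : ∀ x, (∃ J, R x J) ↔ ∃ s, ∃ a, a < s ∧ ∃ b, b < s ∧ ∃ c, c < s ∧ ∃ d, d < s ∧
      R x ⟨a, b, c, d⟩ := by
    refine fun x => ⟨fun ⟨J, h⟩ => ?_, fun ⟨_, a, _, b, _, c, _, d, _, h⟩ => ⟨_, h⟩⟩
    obtain ⟨ha, hb, hc, hd⟩ := entries_lt (lt_add_one_iff.2 (le_refl J.size))
    exact ⟨_, _, ha, _, hb, _, hc, _, hd, h⟩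
  rw [key]
  refine sigma1_induction hM.satisfies (fun x s => ∃ a, a < s ∧ ∃ b, b < s ∧ ∃ c, c < s ∧
    ∃ d, d < s ∧ R x ⟨a, b, c, d⟩) ((key 0).1 zero) (fun x h => (key _).1 ?_) x
  obtain ⟨J, h⟩ := (key x).2 h
  exact succ x J h

theorem exists_le_size (K : Interval M → Prop)
    [BoundedDefinable (M := M) fun γ : ((((Unary M × M.Num) × M.Num) × M.Num) × M.Num) × M.Num =>
      K ⟨γ.1.1.1.2, γ.1.1.2, γ.1.2, γ.2⟩]
    {J : Interval M} (hJ : K J) (hK : ∀ J, K J → ∃ L, K L ∧ J.size < L.size) (x : M.Num) :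
    ∃ J, K J ∧ x ≤ J.size := by
  refine induction (fun x J => K J ∧ x ≤ J.size) ⟨J, hJ, zero_le⟩ (fun x J h => ?_) x
  obtain ⟨L, hL, hlt⟩ := hK J h.1
  exact ⟨L, hL, add_one_le (h.2.trans_lt hlt)⟩

end Interval

/-! ## Codes of pairs and of fractions -/

/-- The code of a pair of numbers. -/
def code (i j : M.Num) : M.Num := (i + j) * (i + j) + i

/-- The code of the fraction `p / q`. -/
def fractionCode (p q : M.Num) : M.Num := code (code p 0) q

theorem code_inj {i j i' j' : M.Num} (h : code i j = code i' j') : i = i' ∧ j = j' := by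
  have aux : ∀ {i j i' j' : M.Num}, code i j = code i' j' → ¬ i + j < i' + j' := by
    intro i j i' j' h hlt
    obtain ⟨k, hk⟩ := exists_of_lt hlt
    have : code i' j' = code i j +
        (j + (i + j) + 1 + (i + j) * k + (i + j) * k + k * k + k + k + i') := by
      simp only [code, hk]
      ring
    rw [← h] at this
    have h0 := left_eq_add.1 this
    simp [add_eq_zero] at h0
  have hs : i + j = i' + j' := le_antisymm (not_lt.1 (aux h.symm)) (not_lt.1 (aux h))
  rw [code, code, hs] at h
  have hi : i = i' := add_left_cancel h
  exact ⟨hi, by rw [hi] at hs; exact add_left_cancel hs⟩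

theorem le_self_mul_self (a : M.Num) : a ≤ a * a := by
  rcases zero_or_succ a with rfl | h
  · simp
  · exact le_mul_of_one_le_left zero_le (by simpa using add_one_le h)

theorem left_le_code (i j : M.Num) : i ≤ code i j := le_add_self

theorem right_le_code (i j : M.Num) : j ≤ code i j :=
  (le_add_self.trans (le_self_mul_self (i + j))).trans le_self_add

theorem left_le_fractionCode (p q : M.Num) : p ≤ fractionCode p q :=
  (left_le_code p 0).trans (left_le_code _ _)

theorem right_le_fractionCode (p q : M.Num) : q ≤ fractionCode p q := right_le_code _ _

theorem fractionCode_inj {p q p' q' : M.Num} (h : fractionCode p q = fractionCode p' q') :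
    p = p' ∧ q = q' :=
  ⟨(code_inj (code_inj h).1).1, (code_inj h).2⟩

instance {Γ : Type u} [Context M Γ] (f g : Γ → M.Num) [TermDefinable f] [TermDefinable g] :
    TermDefinable fun γ => code (f γ) (g γ) := by
  dsimp only [code]
  infer_instance

instance {Γ : Type u} [Context M Γ] (f g : Γ → M.Num) [TermDefinable f] [TermDefinable g] :
    TermDefinable fun γ => fractionCode (f γ) (g γ) := by
  dsimp only [fractionCode]
  infer_instance

/-! ## Generic paths through the Stern–Brocot tree -/

namespace Interval

variable (T : M.Sets)

/-- The set `T` codes the relation `(e, p / q) ∈ T` between numbers and fractions. -/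
def Rel (e p q : M.Num) : Prop := code e (fractionCode p q) ∈ (T : Set M.Num)

instance {Γ : Type u} [Context M Γ] (e p q : Γ → M.Num) [TermDefinable e] [TermDefinable p]
    [TermDefinable q] : BoundedDefinable (M := M) fun γ => Rel T (e γ) (p γ) (q γ) := by
  dsimp only [Rel]
  infer_instance

/-- The requirement `e` is met by an interval of the tree containing `J`: the left end point of that
interval satisfies the `e`-th property, or the right end point does not. -/
def Meets (e : M.Num) (J : Interval M) : Prop :=
  ∃ a, a < J.size + 1 ∧ ∃ b, b < J.size + 1 ∧ ∃ c, c < J.size + 1 ∧ ∃ d, d < J.size + 1 ∧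
    (Unimodular ⟨a, b, c, d⟩ ∧ J.Within ⟨a, b, c, d⟩ ∧ (Rel T e a b ∨ ¬ Rel T e c d))

/-- The first requirement below `J.size` that is not met by `J` calls for the upper part. -/
def GoesUp (J : Interval M) : Prop :=
  ∃ e, e < J.size ∧ ((∀ e', e' < e → Meets T e' J) ∧ ¬ Meets T e J ∧
    Rel T e (J.a + J.c) (J.b + J.d))

open Classical in
/-- The part of `J` that is selected by the requirements. -/
noncomputable def child (J : Interval M) : Interval M := if GoesUp T J then J.upper else J.lower

/-- `J` is reached by starting with the interval from `0` to `1` and always passing to the selected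
part. Equivalently, `J` is contained in the selected part of every larger interval of the
tree. -/
def OnPath (J : Interval M) : Prop :=
  J.Unimodular ∧ J.Within ⟨0, 1, 1, 1⟩ ∧
  ∀ a, a < J.size + 1 → ∀ b, b < J.size + 1 → ∀ c, c < J.size + 1 → ∀ d, d < J.size + 1 →
    (Unimodular ⟨a, b, c, d⟩ → J.Within ⟨a, b, c, d⟩ → ¬ J = ⟨a, b, c, d⟩ →
      (GoesUp T ⟨a, b, c, d⟩ → J.Within (⟨a + c, b + d, c, d⟩ : Interval M)) ∧
      (¬ GoesUp T ⟨a, b, c, d⟩ → J.Within (⟨a, b, a + c, b + d⟩ : Interval M)))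

section Definability

variable {Γ : Type u} [Context M Γ] (a b c d e : Γ → M.Num)
  [TermDefinable a] [TermDefinable b] [TermDefinable c] [TermDefinable d] [TermDefinable e]

instance : BoundedDefinable (M := M) fun γ => Meets T (e γ) ⟨a γ, b γ, c γ, d γ⟩ := by
  dsimp only [Meets]
  infer_instance

instance : BoundedDefinable (M := M) fun γ => GoesUp T ⟨a γ, b γ, c γ, d γ⟩ := by
  dsimp only [GoesUp]
  infer_instance

set_option synthInstance.maxHeartbeats 100000 in
set_option synthInstance.maxSize 1000 in
instance : BoundedDefinable (M := M) fun γ => OnPath T ⟨a γ, b γ, c γ, d γ⟩ := by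
  dsimp only [OnPath]
  infer_instance

end Definability

variable {T} {J K : Interval M}

/-- The bounds in `Meets` cost nothing, since intervals of the tree containing `J` are no larger in
size. -/
theorem meets_iff (hJ : J.Unimodular) {e : M.Num} :
    Meets T e J ↔ ∃ K : Interval M,
    K.Unimodular ∧ J.Within K ∧ (Rel T e K.a K.b ∨ ¬ Rel T e K.c K.d) := by
  refine ⟨fun ⟨a, _, b, _, c, _, d, _, h⟩ => ⟨_, h⟩, fun ⟨K, hK, h, h'⟩ => ?_⟩
  obtain ⟨ha, hb, hc, hd⟩ := entries_lt (lt_add_one_iff.2 (h.size_le hJ hK))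
  exact ⟨_, ha, _, hb, _, hc, _, hd, hK, h, h'⟩

theorem Meets.mono (hJ : J.Unimodular) (hK : K.Unimodular) (h : J.Within K) {e : M.Num}
    (h' : Meets T e K) : Meets T e J := by
  rw [meets_iff hK] at h'
  obtain ⟨L, hL, hKL, h'⟩ := h'
  exact (meets_iff hJ).2 ⟨L, hL, h.trans hK hKL, h'⟩

/-- Here too the bounds are automatic by `Within.size_le`. -/
theorem onPath_iff : OnPath T J ↔ J.Unimodular ∧ J.Within ⟨0, 1, 1, 1⟩ ∧
    ∀ K : Interval M, K.Unimodular → J.Within K → J ≠ K → J.Within (child T K) := by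
  have key : ∀ K : Interval M,
      ((GoesUp T K → J.Within (⟨K.a + K.c, K.b + K.d, K.c, K.d⟩ : Interval M)) ∧
      (¬ GoesUp T K → J.Within (⟨K.a, K.b, K.a + K.c, K.b + K.d⟩ : Interval M))) ↔
      J.Within (child T K) := by
    intro K
    by_cases h : GoesUp T K <;> simp [child, h, upper, lower]
  refine and_congr_right fun hJ => and_congr_right fun _ => ⟨fun h K hK hJK hne => ?_,
    fun h a _ b _ c _ d _ hK hJK hne => ?_⟩
  · obtain ⟨ha, hb, hc, hd⟩ := entries_lt (lt_add_one_iff.2 (hJK.size_le hJ hK))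
    exact (key K).1 (h _ ha _ hb _ hc _ hd hK hJK hne)
  · exact (key _).2 (h _ hK hJK hne)

theorem Unimodular.child (hJ : J.Unimodular) : (child T J).Unimodular := by
  rw [Interval.child]
  split_ifs
  exacts [hJ.upper, hJ.lower]

theorem Unimodular.child_within (hJ : J.Unimodular) : (Interval.child T J).Within J := by
  rw [Interval.child]
  split_ifs
  exacts [hJ.upper_within, hJ.lower_within]

theorem Unimodular.size_lt_child (hJ : J.Unimodular) : J.size < (Interval.child T J).size := by
  rw [Interval.child]
  split_ifs
  exacts [hJ.size_lt_upper, hJ.size_lt_lower]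

theorem within_of_child_within (hJ : J.Unimodular) (hK : K.Unimodular)
    (h : (child T J).Within K) (hne : K ≠ child T J) : J.Within K := by
  rw [child] at h hne
  split_ifs at h hne
  exacts [within_of_upper_within hJ hK h hne, within_of_lower_within hJ hK h hne]

theorem unimodular_root : (⟨0, 1, 1, 1⟩ : Interval M).Unimodular :=
  ⟨by simp, by simp, by simp⟩

/-- There is no larger interval to check: `K` containing the root has `K.a = 0`, so `K.b * K.c = 1`
with `K.d ≤ K.c`, and the remaining entries are `1`. -/
theorem onPath_root : OnPath T (⟨0, 1, 1, 1⟩ : Interval M) := by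
  refine onPath_iff.2 ⟨unimodular_root, .refl _, fun K hK h hne => (hne ?_).elim⟩
  have hl := h.left
  have hr := h.right
  have hdet := hK.det
  simp only [mul_one, zero_mul, one_mul, nonpos_iff_eq_zero] at hl hr
  rw [hl, zero_mul, zero_add] at hdet
  have hb : (1 : M.Num) ≤ K.b := by simpa using add_one_le hK.b_pos
  have hd : (1 : M.Num) ≤ K.d := by simpa using add_one_le hK.d_pos
  have hc : K.c ≤ 1 := hdet ▸ le_mul_of_one_le_left zero_le hb
  have hc1 : K.c = 1 := le_antisymm hc (hd.trans hr)
  have hd1 : K.d = 1 := le_antisymm (hr.trans hc) hd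
  rw [hc1, mul_one] at hdet
  exact Interval.ext hl.symm hdet.symm hc1.symm hd1.symm

theorem OnPath.unimodular (hJ : OnPath T J) : J.Unimodular := hJ.1

theorem OnPath.child (hJ : OnPath T J) : OnPath T (Interval.child T J) := by
  obtain ⟨hu, hroot, hJ⟩ := onPath_iff.1 hJ
  refine onPath_iff.2 ⟨hu.child, hu.child_within.trans hu hroot, fun K hK h hne => ?_⟩
  by_cases hJK : J = K
  · exact hJK ▸ .refl _
  · exact hu.child_within.trans hu
      (hJ K hK (within_of_child_within hu hK h (Ne.symm hne)) hJK)

/-- If neither contains the other, no interval containing both equals one of them, so its selected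
part again contains both. Starting from the root this gives common containing intervals of
arbitrarily large size, against `Within.size_le`. -/
theorem OnPath.within_or_within (hJ : OnPath T J) (hK : OnPath T K) :
    J.Within K ∨ K.Within J := by
  by_contra! hn
  obtain ⟨huJ, hJroot, hJ⟩ := onPath_iff.1 hJ
  obtain ⟨huK, hKroot, hK⟩ := onPath_iff.1 hK
  obtain ⟨a, b, c, d⟩ := J
  obtain ⟨a', b', c', d'⟩ := K
  obtain ⟨L, ⟨huL, hJL, -⟩, hL⟩ := exists_le_size
    (fun L : Interval M => L.Unimodular ∧ Within ⟨a, b, c, d⟩ L ∧ Within ⟨a', b', c', d'⟩ L)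
    ⟨unimodular_root, hJroot, hKroot⟩
    (fun L ⟨huL, hJL, hKL⟩ => ⟨Interval.child T L, ⟨huL.child,
      hJ L huL hJL fun h => hn.2 (h ▸ hKL), hK L huL hKL fun h => hn.1 (h ▸ hJL)⟩,
      huL.size_lt_child⟩)
    (size ⟨a, b, c, d⟩ + 1)
  exact (lt_add_one_iff.2 (hJL.size_le huJ huL)).not_ge hL

theorem OnPath.left_lt_right (hJ : OnPath T J) (hK : OnPath T K) : J.a * K.d < K.c * J.b := by
  rcases hJ.within_or_within hK with h | h
  · exact fraction_lt_of_lt_of_le hK.unimodular.d_pos hJ.unimodular.lt h.right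
  · exact fraction_lt_of_le_of_lt hJ.unimodular.b_pos h.left hK.unimodular.lt

theorem OnPath.exists_le_size (hJ : OnPath T J) (x : M.Num) :
    ∃ K, OnPath T K ∧ K.Within J ∧ x ≤ K.size := by
  obtain ⟨a, b, c, d⟩ := J
  obtain ⟨K, hK, hx⟩ := Interval.exists_le_size
    (fun K : Interval M => OnPath T K ∧ K.Within ⟨a, b, c, d⟩) ⟨hJ, .refl _⟩
    (fun K hK => ⟨Interval.child T K, ⟨hK.1.child,
      hK.1.unimodular.child_within.trans hK.1.unimodular hK.2⟩,
      hK.1.unimodular.size_lt_child⟩) x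
  exact ⟨K, hK.1, hK.2, hx⟩

/-- If `e` is unmet, it is the first unmet requirement, so it alone decides which part is selected,
and the mediant becomes the end point that meets it. -/
theorem meets_child (hJ : J.Unimodular) {e : M.Num} (hlt : e < J.size)
    (he : ∀ e', e' < e → Meets T e' J) : Meets T e (child T J) := by
  by_cases h : Meets T e J
  · exact h.mono hJ.child hJ hJ.child_within
  refine (meets_iff hJ.child).2 ⟨_, hJ.child, .refl _, ?_⟩
  by_cases hup : GoesUp T J
  · left
    rw [child, if_pos hup]
    obtain ⟨e', -, hm, hn, hT⟩ := hup
    have : e' = e := le_antisymm (not_lt.1 fun hlt => h (hm _ hlt))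
      (not_lt.1 fun hlt => hn (he _ hlt))
    exact this ▸ hT
  · right
    rw [child, if_neg hup]
    exact fun hT => hup ⟨e, hlt, he, h, hT⟩

theorem exists_onPath_meets (T : M.Sets) (x : M.Num) : ∃ J, OnPath T J ∧ Meets T x J := by
  suffices ∃ J, OnPath T J ∧ ∀ e, e < x + 1 → Meets T e J from
    this.imp fun J h => ⟨h.1, h.2 x (lt_add_one_iff.2 le_rfl)⟩
  refine induction (fun x J => OnPath T J ∧ ∀ e, e < x → Meets T e J)
    ⟨_, onPath_root, fun e he => (not_lt_zero' e he).elim⟩ (fun x J ⟨hJ, h⟩ => ?_) (x + 1)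
  -- `GoesUp` only looks at requirements below the size, so the path is first followed until the
  -- size exceeds `x`.
  obtain ⟨K, hK, hKJ, hx⟩ := hJ.exists_le_size (x + 1)
  have hm : ∀ e, e < x → Meets T e K := fun e he =>
    (h e he).mono hK.unimodular hJ.unimodular hKJ
  refine ⟨_, hK.child, fun e he => ?_⟩
  rcases (lt_add_one_iff.1 he).lt_or_eq with he | rfl
  · exact (hm e he).mono hK.unimodular.child hK.unimodular hK.unimodular.child_within
  · exact meets_child hK.unimodular ((lt_add_one_iff.2 le_rfl).trans_le hx) hm

end Interval

end ModelsRCA₀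

namespace ModelsRCA₀

variable {M : L2Structure.{u}}

/-! ## Meaning of the sentence -/

/-- `(P, ≼)` is a partial order. -/
structure IsPartialOrderOn (P R : Set M.Num) : Prop where
  mem_of_mem : ∀ x ∈ R, ∃ i j, x = code i j ∧ i ∈ P ∧ j ∈ P
  refl : ∀ x ∈ P, code x x ∈ R
  antisymm : ∀ x y, code x y ∈ R ∧ code y x ∈ R → x = y
  trans : ∀ x y z, code x y ∈ R ∧ code y z ∈ R → code x z ∈ R

/-- `I` is an initial interval of `(P, ≼)`. -/
structure IsInitialInterval (P R I : Set M.Num) : Prop where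
  subset : ∀ x ∈ I, x ∈ P
  mem_of_le : ∀ x y, x ∈ P ∧ y ∈ P ∧ code x y ∈ R ∧ y ∈ I → x ∈ I

/-- `(a - b) / d` is in lowest terms. -/
def IsLowestTerms (a b d : M.Num) : Prop :=
  (a = 0 ∨ b = 0) ∧ 0 < d ∧ ∀ e, (∃ x, e * x = a + b) ∧ (∃ x, e * x = d) → e = 1

/-- `q` is a rational number. -/
def IsRational (q : M.Num) : Prop :=
  ∃ a b d, q = code (code a b) d ∧ IsLowestTerms a b d

/-- The order of the rational numbers. -/
def IsRationalLe (q r : M.Num) : Prop :=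
  ∃ a b d a' b' d', q = code (code a b) d ∧ r = code (code a' b') d' ∧
    (a * d' + b' * d < a' * d + b * d' ∨ a * d' + b' * d = a' * d + b * d')

/-- `F` is the graph of an embedding of the rational numbers into `(P, ≼)`. -/
structure IsEmbeddingOfRationals (P R F : Set M.Num) : Prop where
  mem_of_mem : ∀ x ∈ F, ∃ q y, x = code q y ∧ IsRational q ∧ y ∈ P
  total : ∀ q, IsRational q → ∃ y, code q y ∈ F
  unique : ∀ q y z, code q y ∈ F ∧ code q z ∈ F → y = z
  le_iff : ∀ q r y z, code q y ∈ F ∧ code r z ∈ F →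
    (IsRationalLe q r → code y z ∈ R) ∧ (code y z ∈ R → IsRationalLe q r)

theorem isPartialOrderOn_of_realize {k : ℕ} {P R : Fin k} {v : Fin 0 → M.Num}
    {V : Fin k → M.Sets} (h : (partialOrder P R).Realize M v V) :
    IsPartialOrderOn (V P : Set M.Num) (V R) :=
  ⟨h.1, h.2.1, h.2.2.1, h.2.2.2⟩

theorem isEmbeddingOfRationals_of_realize {k : ℕ} {P R F : Fin k} {v : Fin 0 → M.Num}
    {V : Fin k → M.Sets} (h : (embeddingOfRationals P R F).Realize M v V) :
    IsEmbeddingOfRationals (V P : Set M.Num) (V R) (V F) :=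
  ⟨h.1, h.2.1, h.2.2.1, h.2.2.2⟩

theorem exists_enumeration_of_realize {k : ℕ} {P R : Fin k} {v : Fin 0 → M.Num}
    {V : Fin k → M.Sets} (h : (countablyManyInitialIntervals P R).Realize M v V) :
    ∃ Z : M.Sets, ∀ I : M.Sets, IsInitialInterval (V P : Set M.Num) (V R) I →
      ∃ n, ∀ x, x ∈ (I : Set M.Num) ↔ code n x ∈ (Z : Set M.Num) := by
  obtain ⟨Z, hZ⟩ := h
  refine ⟨Z, fun I hI => ?_⟩
  obtain ⟨n, hn⟩ := hZ I (by
    simpa [initialInterval, Formula.Realize, eval_var, pair, eval_add, eval_mul, Fin.snoc, code]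
      using And.intro hI.subset hI.mem_of_le)
  refine ⟨n, fun x => ?_⟩
  have := hn x
  simp only [Formula.iff, Formula.Realize, Fin.snoc_last, Fin.snoc_castSucc] at this
  exact iff_iff_implies_and_implies.2 this

theorem satisfies_of_forall (h : ∀ P R Z F : M.Sets, IsPartialOrderOn (P : Set M.Num) R →
    (∀ I : M.Sets, IsInitialInterval (P : Set M.Num) R I →
      ∃ n, ∀ x, x ∈ (I : Set M.Num) ↔ code n x ∈ (Z : Set M.Num)) →
    ¬ IsEmbeddingOfRationals (P : Set M.Num) R F) :
    M.Satisfies countablyManyImpliesScattered := by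
  rintro P R ⟨hP, hZ⟩ ⟨F, hF⟩
  obtain ⟨Z, hZ⟩ := exists_enumeration_of_realize hZ
  exact h P R Z F (isPartialOrderOn_of_realize hP) hZ (isEmbeddingOfRationals_of_realize hF)

end ModelsRCA₀

namespace ModelsRCA₀

variable {M : L2Structure.{u}} [hM : ModelsRCA₀ M]

/-! ## Rational numbers -/

/-- The fraction `p / d` is in lowest terms; a bounded version. -/
def Reduced (p d : M.Num) : Prop :=
  0 < d ∧ ∀ e, e < d + 1 → ∀ k, k < p + 1 → ∀ l, l < d + 1 → e * k = p → e * l = d → e = 1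

instance {Γ : Type u} [Context M Γ] (p d : Γ → M.Num) [TermDefinable p] [TermDefinable d] :
    BoundedDefinable (M := M) fun γ => Reduced (p γ) (d γ) := by
  dsimp only [Reduced]
  infer_instance

theorem Reduced.isRational {p d : M.Num} (h : Reduced p d) : IsRational (fractionCode p d) := by
  refine ⟨p, 0, d, rfl, Or.inr rfl, h.1, ?_⟩
  rintro e ⟨⟨k, hk⟩, l, hl⟩
  rw [add_zero] at hk
  have hd := h.1
  rw [← hl] at hd
  have he : 1 ≤ e := by simpa using add_one_le (pos_iff_ne_zero.2 (left_ne_zero_of_mul hd.ne'))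
  have hl' : 1 ≤ l := by simpa using add_one_le (pos_iff_ne_zero.2 (right_ne_zero_of_mul hd.ne'))
  refine h.2 e ?_ k ?_ l ?_ hk hl <;> rw [lt_add_one_iff]
  · exact hl ▸ le_mul_of_one_le_right zero_le hl'
  · exact hk ▸ le_mul_of_one_le_left zero_le he
  · exact hl ▸ le_mul_of_one_le_left zero_le he

/-- A common divisor of the entries of an end point divides the determinant `1`. -/
theorem eq_one_of_mul_eq_mul_add_one {e x y : M.Num} (h : e * x = e * y + 1) : e = 1 := by
  have hlt : y < x := by
    by_contra! hn
    have := mul_le_mul_right hn e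
    rw [h] at this
    exact (lt_add_one_iff.2 le_rfl).not_ge this
  obtain ⟨k, rfl⟩ := exists_of_lt hlt
  have h₁ : e + e * k = 1 := by grind
  have h₂ : e ≤ 1 := h₁ ▸ le_self_add
  rcases zero_or_succ e with rfl | he
  · simp at h₁
  · exact le_antisymm h₂ (by simpa using add_one_le he)

theorem Interval.Unimodular.reduced_left {J : Interval M} (h : J.Unimodular) :
    Reduced J.a J.b := by
  refine ⟨h.b_pos, fun e _ k _ l _ hk hl => ?_⟩
  have := h.det
  rw [← hk, ← hl, mul_assoc, mul_assoc] at this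
  exact eq_one_of_mul_eq_mul_add_one this

theorem Interval.Unimodular.reduced_right {J : Interval M} (h : J.Unimodular) :
    Reduced J.c J.d := by
  refine ⟨h.d_pos, fun e _ k _ l _ hk hl => ?_⟩
  have := h.det
  rw [← hk, ← hl, mul_left_comm, mul_left_comm J.a] at this
  exact eq_one_of_mul_eq_mul_add_one this

theorem isRationalLe_fractionCode {p d p' d' : M.Num} :
    IsRationalLe (fractionCode p d) (fractionCode p' d') ↔ p * d' ≤ p' * d := by
  constructor
  · rintro ⟨a, b, c, a', b', c', h, h', hle⟩
    obtain ⟨hab, rfl⟩ := code_inj h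
    obtain ⟨rfl, rfl⟩ := code_inj hab
    obtain ⟨hab', rfl⟩ := code_inj h'
    obtain ⟨rfl, rfl⟩ := code_inj hab'
    simpa only [zero_mul, add_zero, ← le_iff_lt_or_eq] using hle
  · refine fun h => ⟨p, 0, d, p', 0, d', rfl, rfl, ?_⟩
    simpa only [zero_mul, add_zero, ← le_iff_lt_or_eq] using h

theorem add_self_inj {x y : M.Num} (h : x + x = y + y) : x = y := by
  rcases lt_trichotomy x y with hlt | rfl | hlt
  · exact absurd h (add_lt_add hlt hlt).ne
  · rfl
  · exact absurd h (add_lt_add hlt hlt).ne'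

theorem add_self_ne_add_self_add_one (x y : M.Num) : x + x ≠ y + y + 1 := by
  intro h
  rcases le_or_gt x y with hle | hlt
  · exact (lt_add_one_iff.2 (add_le_add hle hle)).ne h
  · have := add_le_add (add_one_le hlt) (add_one_le hlt)
    rw [h, show y + 1 + (y + 1) = y + y + 1 + 1 by ring] at this
    exact (lt_add_one_iff.2 le_rfl).not_ge this

/-! ## The generic initial interval -/

section

variable (R Z : M.Sets)

/-- The `e`-th property of a point `y`: either `x ≼ y`, where `e = 2 x`, or `y` is not in the `n`-th
set of the sequence `Z`, where `e = 2 n + 1`. -/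
def Property (e y : M.Num) : Prop :=
  (∃ x, x < e + 1 ∧ (e = x + x ∧ code x y ∈ (R : Set M.Num))) ∨
  (∃ n, n < e + 1 ∧ (e = n + n + 1 ∧ ¬ code n y ∈ (Z : Set M.Num)))

instance {Γ : Type u} [Context M Γ] (e y : Γ → M.Num) [TermDefinable e] [TermDefinable y] :
    BoundedDefinable (M := M) fun γ => Property R Z (e γ) (y γ) := by
  dsimp only [Property]
  infer_instance

variable {P R Z F : M.Sets}

theorem property_even {x y : M.Num} : Property R Z (x + x) y ↔ code x y ∈ (R : Set M.Num) := by
  constructor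
  · rintro (⟨x', -, h, h'⟩ | ⟨n, -, h, -⟩)
    · exact add_self_inj h ▸ h'
    · exact (add_self_ne_add_self_add_one _ _ h).elim
  · exact fun h => Or.inl ⟨x, lt_add_one_iff.2 le_self_add, rfl, h⟩

theorem property_odd {n y : M.Num} :
    Property R Z (n + n + 1) y ↔ code n y ∉ (Z : Set M.Num) := by
  constructor
  · rintro (⟨x', -, h, -⟩ | ⟨n', -, h, h'⟩)
    · exact (add_self_ne_add_self_add_one _ _ h.symm).elim
    · exact add_self_inj (add_right_cancel' 1 h) ▸ h'
  · exact fun h => Or.inr ⟨n, lt_add_one_iff.2 (le_self_add.trans le_self_add), rfl, h⟩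

/-- Since `F` is the graph of a function, "the value at `p / d` has the property" can be said with
`∃ y` or with `∀ y`, hence is `Δ⁰₁`. -/
theorem exists_rel_iff_property (hF : IsEmbeddingOfRationals (P : Set M.Num) R F) :
    ∃ T : M.Sets, ∀ e p d y, Reduced p d → code (fractionCode p d) y ∈ (F : Set M.Num) →
      (Interval.Rel T e p d ↔ Property R Z e y) := by
  obtain ⟨T, hT⟩ := delta1_comprehension hM.satisfies
    (fun z y => ∃ e, e < z + 1 ∧ ∃ p, p < z + 1 ∧ ∃ d, d < z + 1 ∧
      (z = code e (fractionCode p d) ∧ Reduced p d ∧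
        code (fractionCode p d) y ∈ (F : Set M.Num) ∧ Property R Z e y))
    (fun z y => ∃ e, e < z + 1 ∧ ∃ p, p < z + 1 ∧ ∃ d, d < z + 1 ∧
      (z = code e (fractionCode p d) ∧ Reduced p d ∧
        (code (fractionCode p d) y ∈ (F : Set M.Num) → Property R Z e y))) (by
      refine fun z => ⟨?_, fun h => ?_⟩
      · rintro ⟨y, e, he, p, hp, d, hd, hz, hpd, hy, h⟩ y'
        exact ⟨e, he, p, hp, d, hd, hz, hpd, fun hy' => hF.unique _ _ _ ⟨hy, hy'⟩ ▸ h⟩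
      -- The value `0` is arbitrary: it serves only to decode `z`. The true value `y` is inserted
      -- afterwards.
      · obtain ⟨e, he, p, hp, d, hd, hz, hpd, -⟩ := h 0
        obtain ⟨y, hy⟩ := hF.total _ hpd.isRational
        obtain ⟨e', -, p', -, d', -, hz', -, h'⟩ := h y
        obtain ⟨rfl, h₁⟩ := code_inj (hz.symm.trans hz')
        obtain ⟨rfl, rfl⟩ := fractionCode_inj h₁
        exact ⟨y, e, he, p, hp, d, hd, hz, hpd, hy, h' hy⟩)
  refine ⟨T, fun e p d y hpd hy => (hT _).trans ⟨?_, fun h => ?_⟩⟩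
  · rintro ⟨y', e', -, p', -, d', -, hz, -, hy', h⟩
    obtain ⟨rfl, h₁⟩ := code_inj hz
    obtain ⟨rfl, rfl⟩ := fractionCode_inj h₁
    exact hF.unique _ _ _ ⟨hy', hy⟩ ▸ h
  · have hle : fractionCode p d < code e (fractionCode p d) + 1 :=
      lt_add_one_iff.2 (right_le_code _ _)
    exact ⟨y, e, lt_add_one_iff.2 (left_le_code _ _), p,
      (left_le_fractionCode p d).trans_lt hle, d, (right_le_fractionCode p d).trans_lt hle,
      rfl, hpd, hy, h⟩

theorem exists_set_iff_onPath (T : M.Sets)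
    (h : ∀ x, (∃ J, Interval.OnPath T J ∧ Interval.Rel T (x + x) J.a J.b) ↔
      ∀ J, Interval.OnPath T J → Interval.Rel T (x + x) J.c J.d) :
    ∃ I : M.Sets, ∀ x, x ∈ (I : Set M.Num) ↔
      ∃ J, Interval.OnPath T J ∧ Interval.Rel T (x + x) J.a J.b := by
  have entries : ∀ J : Interval M, ∃ s, J.a < s ∧ J.b < s ∧ J.c < s ∧ J.d < s := fun J =>
    ⟨_, Interval.entries_lt (lt_add_one_iff.2 (le_refl J.size))⟩
  have hex : ∀ x, (∃ s, ∃ a, a < s ∧ ∃ b, b < s ∧ ∃ c, c < s ∧ ∃ d, d < s ∧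
      (Interval.OnPath T ⟨a, b, c, d⟩ ∧ Interval.Rel T (x + x) a b)) ↔
      ∃ J, Interval.OnPath T J ∧ Interval.Rel T (x + x) J.a J.b := by
    refine fun x => ⟨fun ⟨_, a, _, b, _, c, _, d, _, h⟩ => ⟨⟨a, b, c, d⟩, h⟩, fun ⟨J, h⟩ => ?_⟩
    obtain ⟨s, ha, hb, hc, hd⟩ := entries J
    exact ⟨s, J.a, ha, J.b, hb, J.c, hc, J.d, hd, h⟩
  obtain ⟨I, hI⟩ := delta1_comprehension hM.satisfies
    (fun x s => ∃ a, a < s ∧ ∃ b, b < s ∧ ∃ c, c < s ∧ ∃ d, d < s ∧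
      (Interval.OnPath T ⟨a, b, c, d⟩ ∧ Interval.Rel T (x + x) a b))
    (fun x s => ∀ a, a < s → ∀ b, b < s → ∀ c, c < s → ∀ d, d < s →
      (Interval.OnPath T ⟨a, b, c, d⟩ → Interval.Rel T (x + x) c d)) (by
      intro x
      rw [hex x, h x]
      refine ⟨fun h s a _ b _ c _ d _ hJ => h ⟨a, b, c, d⟩ hJ, fun h J hJ => ?_⟩
      obtain ⟨s, ha, hb, hc, hd⟩ := entries J
      exact h s J.a ha J.b hb J.c hc J.d hd hJ)
  exact ⟨I, fun x => (hI x).trans (hex x)⟩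

theorem not_isEmbeddingOfRationals (hP : IsPartialOrderOn (P : Set M.Num) R)
    (hZ : ∀ I : M.Sets, IsInitialInterval (P : Set M.Num) R I →
      ∃ n, ∀ x, x ∈ (I : Set M.Num) ↔ code n x ∈ (Z : Set M.Num)) :
    ¬ IsEmbeddingOfRationals (P : Set M.Num) R F := by
  intro hF
  obtain ⟨T, hT⟩ := exists_rel_iff_property (Z := Z) hF
  have total : ∀ {p d : M.Num}, Reduced p d →
      ∃ y ∈ (P : Set M.Num), code (fractionCode p d) y ∈ (F : Set M.Num) := by
    intro p d h
    obtain ⟨y, hy⟩ := hF.total _ h.isRational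
    obtain ⟨q, z, hqz, -, hz⟩ := hF.mem_of_mem _ hy
    exact ⟨y, (code_inj hqz).2 ▸ hz, hy⟩
  have le_iff : ∀ {p d p' d' y z : M.Num}, code (fractionCode p d) y ∈ (F : Set M.Num) →
      code (fractionCode p' d') z ∈ (F : Set M.Num) →
      (code y z ∈ (R : Set M.Num) ↔ p * d' ≤ p' * d) := fun hy hz =>
    (iff_iff_implies_and_implies.2 (hF.le_iff _ _ _ _ ⟨hy, hz⟩).symm).trans
      isRationalLe_fractionCode
  -- The even properties are upward closed in the rationals.
  have mono : ∀ {p d p' d' x : M.Num}, Reduced p d → Reduced p' d' → p * d' ≤ p' * d →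
      Interval.Rel T (x + x) p d → Interval.Rel T (x + x) p' d' := by
    intro p d p' d' x h h' hle hx
    obtain ⟨y, -, hy⟩ := total h
    obtain ⟨z, -, hz⟩ := total h'
    rw [hT _ _ _ _ h hy, property_even] at hx
    rw [hT _ _ _ _ h' hz, property_even]
    exact hP.trans _ _ _ ⟨hx, (le_iff hy hz).2 hle⟩
  obtain ⟨I, hI⟩ := exists_set_iff_onPath T fun x => by
    refine ⟨fun ⟨J, hJ, hx⟩ K hK => mono hJ.unimodular.reduced_left hK.unimodular.reduced_right
      (hJ.left_lt_right hK).le hx, fun h => ?_⟩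
    -- Genericity for `2x`: the end points of `K` enclose those of `J`, so a positive answer at the
    -- left of `K` passes to the left of `J`, and a negative one at the right of `K` to the right of
    -- `J`.
    obtain ⟨J, hJ, hm⟩ := Interval.exists_onPath_meets T (x + x)
    obtain ⟨K, hK, hJK, hl | hr⟩ := (Interval.meets_iff hJ.unimodular).1 hm
    · exact ⟨J, hJ, mono hK.reduced_left hJ.unimodular.reduced_left hJK.left hl⟩
    · exact (hr (mono hJ.unimodular.reduced_right hK.reduced_right hJK.right (h J hJ))).elim
  have hIP : IsInitialInterval (P : Set M.Num) R I := by
    refine ⟨fun x hx => ?_, fun x y ⟨_, _, hxy, hy⟩ => ?_⟩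
    · obtain ⟨J, hJ, hx⟩ := (hI x).1 hx
      obtain ⟨y, -, hy⟩ := total hJ.unimodular.reduced_left
      rw [hT _ _ _ _ hJ.unimodular.reduced_left hy, property_even] at hx
      obtain ⟨i, j, hij, hi, -⟩ := hP.mem_of_mem _ hx
      exact (code_inj hij).1 ▸ hi
    · obtain ⟨J, hJ, hy⟩ := (hI y).1 hy
      obtain ⟨z, -, hz⟩ := total hJ.unimodular.reduced_left
      rw [hT _ _ _ _ hJ.unimodular.reduced_left hz, property_even] at hy
      refine (hI x).2 ⟨J, hJ, ?_⟩
      rw [hT _ _ _ _ hJ.unimodular.reduced_left hz, property_even]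
      exact hP.trans _ _ _ ⟨hxy, hy⟩
  obtain ⟨n, hn⟩ := hZ I hIP
  -- Diagonalization against `Iₙ = I`: either the image of the left end point of `K` is outside
  -- `Iₙ`, though it is below the image of the left end point of `J` and so in `I`; or the image of
  -- the right end point of `K` is in `Iₙ`, though that end point is above every left end point of
  -- the path.
  obtain ⟨J, hJ, hm⟩ := Interval.exists_onPath_meets T (n + n + 1)
  obtain ⟨K, hK, hJK, hl | hr⟩ := (Interval.meets_iff hJ.unimodular).1 hm
  · obtain ⟨y, -, hy⟩ := total hK.reduced_left
    obtain ⟨z, -, hz⟩ := total hJ.unimodular.reduced_left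
    rw [hT _ _ _ _ hK.reduced_left hy, property_odd] at hl
    refine hl ((hn y).1 ((hI y).2 ⟨J, hJ, ?_⟩))
    rw [hT _ _ _ _ hJ.unimodular.reduced_left hz, property_even]
    exact (le_iff hy hz).2 hJK.left
  · obtain ⟨y, -, hy⟩ := total hK.reduced_right
    rw [hT _ _ _ _ hK.reduced_right hy, property_odd, not_not, ← hn, hI] at hr
    obtain ⟨L, hL, hr⟩ := hr
    obtain ⟨z, -, hz⟩ := total hL.unimodular.reduced_left
    rw [hT _ _ _ _ hL.unimodular.reduced_left hz, property_even, le_iff hy hz] at hr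
    exact (hL.left_lt_right hJ).not_ge (fraction_le_trans hK.d_pos hJK.right hr)

end

end ModelsRCA₀

end SecondOrderArithmetic

theorem theorem5p2 :
    SecondOrderArithmetic.Entails.{u} SecondOrderArithmetic.RCA₀
      SecondOrderArithmetic.countablyManyImpliesScattered := by
  intro M h
  have : SecondOrderArithmetic.ModelsRCA₀ M := ⟨h⟩
  exact SecondOrderArithmetic.ModelsRCA₀.satisfies_of_forall fun P R Z F hP hZ =>
    SecondOrderArithmetic.ModelsRCA₀.not_isEmbeddingOfRationals hP hZ
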